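/- **Setting.** Let $\mathbb D=\{|z|<1\}$, let $\mathbb S=\{0<\Re z<1\}$, and let $\omega:\mathbb D\to\mathbb S$ be a function that extends analytically to a neighbourhood of $\overline{\mathbb D}$. Put $p(z)=1/\Re\omega(z)\in[1,\infty]$ for $z\in\overline{\mathbb D}$. Let $\mathscr Z[\omega]$ be the space of all continuous $F:\overline{\mathbb D}\to\ell_\infty$ that are analytic on $\mathbb D$ and satisfy $\|F\|=\sup_{|z|\le 1}\|F(z)\|_{\ell_{p(z)}}<\infty$. A Banach space $\mathscr F$ of analytic functions $\mathbb D\to\Sigma$ ($\Sigma$ a complex Banach space) is *admissible* if all evaluations $\delta_z:\mathscr F\to\Sigma$ are bounded and if, for each conformal $\varphi:\mathbb D\to\mathbb D$ and each analytic $f:\mathbb D\to\Sigma$, one has $f\in\mathscr F$ if and only if $\varphi f\in\mathscr F$, and then $\|\varphi f\|=\|f\|$. For $z\in\mathbb D$ and $n\ge1$ let $\mathscr F^{(n)}_z$ be the space of all lists $\big(f^{(n-1)}(z)/(n-1)!,\dots,f'(z),f(z)\big)$, $f\in\mathscr F$, with the quotient norm; write $\mathscr F_z=\mathscr F^{(1)}_z$.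 For $C>1$ choose, for each $x\in\mathscr F^{(n)}_z$, a function $f_x\in\mathscr F$ that has the list $x$ at $z$, with $\|f_x\|\le C\|x\|$ and with $f_x$ depending homogeneously on $x$. Such choices exist. The corresponding differential is $$\Omega^{n,m}_z(x)=\Big(\tfrac{f_x^{(n+m-1)}(z)}{(n+m-1)!},\dots,\tfrac{f_x^{(n)}(z)}{n!}\Big)\in\Sigma^m .$$ A map $\Phi:\mathscr F_z^{(n)}\to\Sigma^m$ is *bounded* if it takes values in $\mathscr F_z^{(m)}$ and $\|\Phi(x)\|_{\mathscr F_z^{(m)}}\le M\|x\|_{\mathscr F_z^{(n)}}$ for some $M$ and all $x$. It is *trivial* if $\Phi-L$ is bounded for some linear (not necessarily continuous) map $L:\mathscr F_z^{(n)}\to\Sigma^m$. Two choices of $\Omega^{n,m}_z$ differ by a bounded map. Accordingly, $\Omega^{n,m}_z=0$ means that every choice of $\Omega_z^{n,m}$ is bounded and that, for some constant $C$, some choice is identically zero (for $n=1$ this is required for every $C>1$); $\Omega^{n,m}_z\nsim0$ means that no choice is trivial. **Proposition.** $\mathscr Z[\omega]$ is admissible. If $\zeta\in\mathbb D$ and $\omega'$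 has a zero of order $k\ge1$ at $\zeta$, then for all $n,m\ge1$ the differentials of $\mathscr Z[\omega]$ at $\zeta$ satisfy $$\Omega^{n,m}_\zeta=0\ \text{ if } n+m\le k+1,\qquad \Omega^{n,m}_\zeta\nsim0\ \text{ if } n+m\ge k+2 .$$ Consequently: 1. (Negative answer to Rochberg's question whether $\Omega^{1,j}(f)$ depends only on $f$ and $\Omega^{1,1}(f)$.) For each $N\ge2$ there are an admissible space $\mathscr F$ of $\ell_\infty$-valued functions on $\mathbb D$ and $\zeta\in\mathbb D$ such that $\mathscr F_\zeta=\ell_2$ isometrically, $\Omega^{1,j}_\zeta=0$ for $1\le j<N$, and $\Omega^{1,j}_\zeta\nsim0$ for all $j\ge N$. 2. (Negative answer to the problem whether nontriviality of the higher differentials forces nontriviality of $\Omega^{1,1}$.) There are an admissible space $\mathscr F$ of $\ell_\infty$-valued functions on $\mathbb D$ and $\zeta\in\mathbb D$ such that $\Omega^{1,1}_\zeta=0$ but $\Omega^{n,m}_\zeta\nsim0$ for all $n,m\ge1$ with $(n,m)\ne(1,1)$. -/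

import Mathlib

open Set Filter Topology MeasureTheory
open scoped ENNReal

noncomputable section

namespace Rochberg

/-- The open unit disc. -/
abbrev disc : Set ℂ := Metric.ball (0 : ℂ) 1

/-- The open unit strip `0 < Re z < 1`. -/
def strip : Set ℂ := {z | 0 < z.re ∧ z.re < 1}

/-- `φ` is a conformal equivalence from `U` onto the unit disc. -/
def IsConformalEquiv (U : Set ℂ) (φ : ℂ → ℂ) : Prop :=
  DifferentiableOn ℂ φ U ∧ BijOn φ U disc

section General

variable {E : Type*} [NormedAddCommGroup E] [NormedSpace ℂ E] [CompleteSpace E]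

/-- The `i`-th Taylor coefficient `f⁽ⁱ⁾(z) / i!`. -/
def taylorCoeff (f : ℂ → E) (z : ℂ) (i : ℕ) : E :=
  ((Nat.factorial i : ℂ)⁻¹) • iteratedDeriv i f z

theorem taylorCoeff_add {f g : ℂ → E} {z : ℂ} (hf : AnalyticAt ℂ f z) (hg : AnalyticAt ℂ g z)
    (i : ℕ) : taylorCoeff (f + g) z i = taylorCoeff f z i + taylorCoeff g z i := by
  have h := iteratedDeriv_add (n := i) (hf.contDiffAt (n := i)) (hg.contDiffAt (n := i))
  simp only [taylorCoeff, h, smul_add]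

theorem taylorCoeff_smul {f : ℂ → E} {z : ℂ} (hf : AnalyticAt ℂ f z) (c : ℂ) (i : ℕ) :
    taylorCoeff (c • f) z i = c • taylorCoeff f z i := by
  have h := iteratedDeriv_const_smul (n := i) (hf.contDiffAt (n := i)) c
  simp only [taylorCoeff, h, smul_comm c]

/-- A linear space of analytic functions `U → E` together with a size function `norm` (that it is
a complete norm is part of `IsAdmissible`). A function on `U` is represented by the total function
that extends it by zero outside `U`. -/
structure FunctionSpace (U : Set ℂ) (E : Type*) [NormedAddCommGroup E] [NormedSpace ℂ E] where
  carrier : Submodule ℂ (ℂ → E)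
  analytic : ∀ f ∈ carrier, AnalyticOnNhd ℂ f U
  zero_off : ∀ f ∈ carrier, ∀ z ∉ U, f z = 0
  norm : (ℂ → E) → ℝ

namespace FunctionSpace

variable {U : Set ℂ}

/-- Admissible spaces of analytic functions on `U`. -/
structure IsAdmissible (F : FunctionSpace U E) : Prop where
  isOpen : IsOpen U
  conformal : ∃ φ, IsConformalEquiv U φ
  norm_nonneg : ∀ f ∈ F.carrier, 0 ≤ F.norm f
  norm_eq_zero : ∀ f ∈ F.carrier, (F.norm f = 0 ↔ f = 0)
  norm_add_le : ∀ f ∈ F.carrier, ∀ g ∈ F.carrier, F.norm (f + g) ≤ F.norm f + F.norm g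
  norm_smul : ∀ (c : ℂ), ∀ f ∈ F.carrier, F.norm (c • f) = ‖c‖ * F.norm f
  complete : ∀ u : ℕ → ℂ → E, (∀ i, u i ∈ F.carrier) →
    (∀ ε > 0, ∃ N, ∀ i ≥ N, ∀ j ≥ N, F.norm (u i - u j) < ε) →
    ∃ f ∈ F.carrier, Tendsto (fun i => F.norm (u i - f)) atTop (𝓝 0)
  eval_bounded : ∀ z ∈ U, ∃ C : ℝ, ∀ f ∈ F.carrier, ‖f z‖ ≤ C * F.norm f
  mul_mem_iff : ∀ φ, IsConformalEquiv U φ → ∀ f : ℂ → E, AnalyticOnNhd ℂ f U →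
    (∀ z ∉ U, f z = 0) → (f ∈ F.carrier ↔ (fun z => φ z • f z) ∈ F.carrier)
  norm_mul : ∀ φ, IsConformalEquiv U φ → ∀ f ∈ F.carrier,
    F.norm (fun z => φ z • f z) = F.norm f

/-- The map sending `f` in the space to the list of its first `n` Taylor coefficients at `z`;
entry `i` is the coefficient of order `i`. -/
def jet (F : FunctionSpace U E) (z : U) (n : ℕ) : F.carrier →ₗ[ℂ] (Fin n → E) where
  toFun f := fun i => taylorCoeff (f : ℂ → E) z i
  map_add' f g := by
    funext i
    exact taylorCoeff_add (F.analytic _ f.2 z z.2) (F.analytic _ g.2 z z.2) i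
  map_smul' c f := by
    funext i
    exact taylorCoeff_smul (F.analytic _ f.2 z z.2) c i

/-- The `n`-th Rochberg space at `z`: all lists of the first `n` Taylor coefficients at `z` of
functions in the space. -/
def space (F : FunctionSpace U E) (z : U) (n : ℕ) : Submodule ℂ (Fin n → E) :=
  LinearMap.range (F.jet z n)

/-- The quotient norm of the `n`-th Rochberg space at `z`. -/
def quotNorm (F : FunctionSpace U E) (z : U) (n : ℕ) (x : Fin n → E) : ℝ :=
  sInf {r : ℝ | ∃ f : F.carrier, F.jet z n f = x ∧ F.norm (f : ℂ → E) = r}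

/-- `s` is a homogeneous choice, for each `x` in the `n`-th Rochberg space at `z`, of a function
`s x` in the space with the list of Taylor coefficients `x` and norm at most `C * ‖x‖`. -/
structure IsSelection (F : FunctionSpace U E) (z : U) (n : ℕ) (C : ℝ)
    (s : F.space z n → F.carrier) : Prop where
  jet_eq : ∀ x, F.jet z n (s x) = x
  norm_le : ∀ x, F.norm (s x : ℂ → E) ≤ C * F.quotNorm z n x
  smul : ∀ (c : ℂ) x, s (c • x) = c • s x

/-- The differential `Ω^{n,m}` at `z` defined by the selection `s`: `x` is sent to the list of
the Taylor coefficients of `s x` at `z` of the orders `n, …, n + m - 1`. -/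
def differential (F : FunctionSpace U E) (z : U) (n m : ℕ) (s : F.space z n → F.carrier) :
    F.space z n → (Fin m → E) :=
  fun x j => taylorCoeff (s x : ℂ → E) z (n + j)

/-- A map from the `n`-th Rochberg space to `E^m` is bounded into the `m`-th Rochberg space. -/
def IsBoundedMap (F : FunctionSpace U E) (z : U) (n m : ℕ)
    (Φ : F.space z n → (Fin m → E)) : Prop :=
  ∃ M : ℝ, ∀ x, Φ x ∈ F.space z m ∧ F.quotNorm z m (Φ x) ≤ M * F.quotNorm z n x

/-- `Φ`, as a quasilinear map from the `n`-th to the `m`-th Rochberg space, is trivial: it is at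
bounded distance from a (not necessarily continuous) linear map `L`. Equivalently `x ↦ (L x, x)`
is a bounded linear section of the twisted sum defined by `Φ`. -/
def IsTrivial (F : FunctionSpace U E) (z : U) (n m : ℕ)
    (Φ : F.space z n → (Fin m → E)) : Prop :=
  ∃ L : F.space z n →ₗ[ℂ] (Fin m → E), F.IsBoundedMap z n m (fun x => Φ x - L x)

/-- `Ω^{n,m} = 0` at `z`. Since differentials are determined up to bounded maps only, this says
that every choice of the differential is bounded and that some choice is the zero map. For
`n = 1` the latter choice can be made with selections that are almost optimal. -/
def DifferentialVanishes (F : FunctionSpace U E) (z : U) (n m : ℕ) : Prop :=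
  (∀ (C : ℝ) (s : F.space z n → F.carrier), F.IsSelection z n C s →
    F.IsBoundedMap z n m (F.differential z n m s)) ∧
  (∃ (C : ℝ) (s : F.space z n → F.carrier), F.IsSelection z n C s ∧
    ∀ x, F.differential z n m s x = 0) ∧
  (n = 1 → ∀ C > 1, ∃ s : F.space z n → F.carrier, F.IsSelection z n C s ∧
    ∀ x, F.differential z n m s x = 0)

/-- `Ω^{n,m} ≁ 0` at `z`: no choice of the differential is trivial. Selections with any constant
greater than `1` exist, so that there are such choices. -/
def DifferentialNontrivial (F : FunctionSpace U E) (z : U) (n m : ℕ) : Prop :=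
  (∀ C > 1, ∃ s : F.space z n → F.carrier, F.IsSelection z n C s) ∧
  ∀ (C : ℝ) (s : F.space z n → F.carrier), F.IsSelection z n C s →
    ¬ F.IsTrivial z n m (F.differential z n m s)

end FunctionSpace

end General

/-- The space `ℓ_∞` of bounded complex sequences. -/
abbrev LInf : Type := lp (fun _ : ℕ => ℂ) ∞

/-- The `ℓ_p` norm, with values in `[0, ∞]`, of a bounded sequence. -/
def lpNorm (p : ℝ≥0∞) (x : LInf) : ℝ≥0∞ :=
  eLpNorm (fun i : ℕ => x i) p Measure.count

/-- An analytic function from the unit disc to the unit strip with an analytic extension to a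
neighbourhood of the closed unit disc (the values far from the closed disc play no role). -/
structure Config where
  toFun : ℂ → ℂ
  analytic : AnalyticOnNhd ℂ toFun (Metric.closedBall 0 1)
  mapsTo : MapsTo toFun disc strip

/-- The exponent `p(z) = 1 / Re ω(z)`, which is `∞` where `Re ω(z) = 0` (possible only for
`|z| = 1`). -/
def Config.p (ω : Config) (z : ℂ) : ℝ≥0∞ := (ENNReal.ofReal (ω.toFun z).re)⁻¹

theorem Config.one_le_p (ω : Config) {z : ℂ} (hz : z ∈ Metric.closedBall (0 : ℂ) 1) :
    1 ≤ ω.p z := by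
  have h1 : z ∈ closure disc := by rwa [closure_ball (0 : ℂ) one_ne_zero]
  have h2 : ContinuousOn (fun w => (ω.toFun w).re) (closure disc) := by
    rw [closure_ball (0 : ℂ) one_ne_zero]
    exact Complex.continuous_re.comp_continuousOn ω.analytic.continuousOn
  have h3 : (ω.toFun z).re ≤ 1 := by
    refine closure_minimal (s := (fun w => (ω.toFun w).re) '' disc) (t := Iic 1) ?_ isClosed_Iic
      (h2.image_closure (mem_image_of_mem _ h1))
    rintro _ ⟨w, hw, rfl⟩
    exact (ω.mapsTo hw).2.le
  rw [Config.p, ENNReal.one_le_inv]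
  exact ENNReal.ofReal_le_one.2 h3

/-- The continuous extension to the closed disc (where it exists) of a function on the disc. -/
def bdryExt (f : ℂ → LInf) : ℂ → LInf := extendFrom disc f

/-- `sup_{|z| ≤ 1} ‖f(z)‖_{p(z)}`, with values in `[0, ∞]`. -/
def supNorm (ω : Config) (f : ℂ → LInf) : ℝ≥0∞ :=
  ⨆ z ∈ Metric.closedBall (0 : ℂ) 1, lpNorm (ω.p z) (bdryExt f z)

theorem tendsto_bdryExt {f : ℂ → LInf} (hf : AnalyticOnNhd ℂ f disc)
    (hc : ContinuousOn (bdryExt f) (Metric.closedBall 0 1)) {z : ℂ}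
    (hz : z ∈ Metric.closedBall (0 : ℂ) 1) : Tendsto f (𝓝[disc] z) (𝓝 (bdryExt f z)) := by
  refine ((hc z hz).mono Metric.ball_subset_closedBall).congr' ?_
  filter_upwards [self_mem_nhdsWithin] with w hw
  exact extendFrom_eq (subset_closure hw) (hf.continuousOn w hw)

theorem bdryExt_add {f g : ℂ → LInf} (hf : AnalyticOnNhd ℂ f disc)
    (hfc : ContinuousOn (bdryExt f) (Metric.closedBall 0 1)) (hg : AnalyticOnNhd ℂ g disc)
    (hgc : ContinuousOn (bdryExt g) (Metric.closedBall 0 1)) {z : ℂ}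
    (hz : z ∈ Metric.closedBall (0 : ℂ) 1) :
    bdryExt (f + g) z = bdryExt f z + bdryExt g z := by
  refine extendFrom_eq ?_ ((tendsto_bdryExt hf hfc hz).add (tendsto_bdryExt hg hgc hz))
  rwa [closure_ball (0 : ℂ) one_ne_zero]

theorem bdryExt_smul {f : ℂ → LInf} (hf : AnalyticOnNhd ℂ f disc)
    (hfc : ContinuousOn (bdryExt f) (Metric.closedBall 0 1)) (c : ℂ) {z : ℂ}
    (hz : z ∈ Metric.closedBall (0 : ℂ) 1) :
    bdryExt (c • f) z = c • bdryExt f z := by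
  refine extendFrom_eq ?_ ((tendsto_bdryExt hf hfc hz).const_smul c)
  rwa [closure_ball (0 : ℂ) one_ne_zero]

theorem bdryExt_zero {z : ℂ} (hz : z ∈ Metric.closedBall (0 : ℂ) 1) :
    bdryExt (0 : ℂ → LInf) z = 0 := by
  refine extendFrom_eq ?_ tendsto_const_nhds
  rwa [closure_ball (0 : ℂ) one_ne_zero]

theorem lpNorm_add_le {p : ℝ≥0∞} (hp : 1 ≤ p) (x y : LInf) :
    lpNorm p (x + y) ≤ lpNorm p x + lpNorm p y :=
  eLpNorm_add_le (f := fun i : ℕ => x i) (g := fun i : ℕ => y i)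
    (measurable_of_countable _).aestronglyMeasurable
    (measurable_of_countable _).aestronglyMeasurable hp

theorem lpNorm_smul (p : ℝ≥0∞) (c : ℂ) (x : LInf) :
    lpNorm p (c • x) = ‖c‖ₑ * lpNorm p x :=
  eLpNorm_const_smul c (fun i : ℕ => x i) p Measure.count

/-- The space `𝒵[ω]` of all continuous functions on the closed disc with values in `ℓ_∞`, analytic
on the disc, with finite norm `sup_{|z| ≤ 1} ‖f(z)‖_{p(z)}`. An element is represented by its
restriction to the open disc, which determines it. -/
def spaceZ (ω : Config) : FunctionSpace disc LInf where
  carrier :=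
    { carrier := {f | AnalyticOnNhd ℂ f disc ∧ (∀ z ∉ disc, f z = 0) ∧
        ContinuousOn (bdryExt f) (Metric.closedBall 0 1) ∧ supNorm ω f < ∞}
      zero_mem' := by
        refine ⟨fun z _ => analyticAt_const, fun _ _ => rfl, ?_, ?_⟩
        · exact continuousOn_const.congr (fun z hz => bdryExt_zero hz)
        · have : supNorm ω 0 ≤ 0 := by
            refine iSup₂_le fun z hz => ?_
            rw [bdryExt_zero hz]
            exact (eLpNorm_zero (ε := ℂ) (p := ω.p z) (μ := (Measure.count : Measure ℕ))).le
          exact this.trans_lt (by simp)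
      add_mem' := by
        rintro f g ⟨hf, hf0, hfc, hfn⟩ ⟨hg, hg0, hgc, hgn⟩
        refine ⟨fun z hz => (hf z hz).add (hg z hz), fun z hz => ?_, ?_, ?_⟩
        · simp [hf0 z hz, hg0 z hz]
        · exact (hfc.add hgc).congr fun z hz => bdryExt_add hf hfc hg hgc hz
        · refine lt_of_le_of_lt (iSup₂_le fun z hz => ?_) (ENNReal.add_lt_top.2 ⟨hfn, hgn⟩)
          rw [bdryExt_add hf hfc hg hgc hz]
          refine (lpNorm_add_le (ω.one_le_p hz) _ _).trans (add_le_add ?_ ?_)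
          · exact le_iSup₂ (f := fun z (_ : z ∈ Metric.closedBall (0 : ℂ) 1) =>
              lpNorm (ω.p z) (bdryExt f z)) z hz
          · exact le_iSup₂ (f := fun z (_ : z ∈ Metric.closedBall (0 : ℂ) 1) =>
              lpNorm (ω.p z) (bdryExt g z)) z hz
      smul_mem' := by
        rintro c f ⟨hf, hf0, hfc, hfn⟩
        refine ⟨fun z hz => (hf z hz).const_smul, fun z hz => ?_, ?_, ?_⟩
        · simp [hf0 z hz]
        · exact (hfc.const_smul c).congr fun z hz => bdryExt_smul hf hfc c hz
        · refine lt_of_le_of_lt (iSup₂_le fun z hz => ?_)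
            (ENNReal.mul_lt_top (a := ‖c‖ₑ) enorm_lt_top hfn)
          rw [bdryExt_smul hf hfc c hz, lpNorm_smul]
          gcongr
          exact le_iSup₂ (f := fun z (_ : z ∈ Metric.closedBall (0 : ℂ) 1) =>
            lpNorm (ω.p z) (bdryExt f z)) z hz }
  analytic := fun _ hf => hf.1
  zero_off := fun _ hf => hf.2.1
  norm := fun f => (supNorm ω f).toReal

/-- The first Rochberg space at `z` is `ℓ_p` with its usual norm. -/
def FibreIsLp (F : FunctionSpace disc LInf) (z : disc) (p : ℝ≥0∞) : Prop :=
  ∀ x : LInf, ((fun _ => x) ∈ F.space z 1 ↔ lpNorm p x < ∞) ∧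
    (lpNorm p x < ∞ → F.quotNorm z 1 (fun _ => x) = (lpNorm p x).toReal)

end Rochberg

end

/-! Near ζ one has ω - ω(ζ) = (z - ζ)^N h with N = k + 1 and h(ζ) ≠ 0 (`Config.exists_isFactor`);
the differentials at ζ are governed by N and h(ζ).

Norms are handled by duality. The ℓ_{1/θ} norm of x is the supremum of ∑ |x_i| b_i^(1-θ) over
nonnegative b in the unit ball of ℓ_1, and b_i^(1-ω(z)) is analytic in z with the right modulus at
every z. Hence ‖F(z)‖_{p(z)} obeys a maximum principle (`lpNorm_le_of_sphere`), and norms are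
determined on the circle. There conformal self-maps of the disc have modulus 1, which gives
admissibility, and z - ζ is bounded away from 0, so that division by powers of z - ζ is bounded.

Vanishing: an almost optimal function through x in ℓ_{p(ζ)} has the coordinates x_i
(|x_i|/ρ_i)^((ω(z)-ω(ζ))/θ), θ = Re ω(ζ). It depends on z through ω only, so its Taylor coefficients
of orders 1, …, N - 1 vanish (`spaceZ_exists_extremal`). Sums of such functions times powers of z -
ζ realise any jet of length n ≤ N with zero coefficients at the orders n, …, N - 1
(`Config.IsFactor.exists_truncation`). For n + m ≤ N the differential reads only these orders.

Nontriviality: let g have a vector of signs ε, supported on a finite set S, as its coefficient of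
order j, and zeros before it. Average the coordinates of g against ε over S and multiply by
|S|^(ω(z)-ω(ζ)). The result is bounded on the disc by ‖g‖ |S|^(-θ), and its coefficient of order N +
j contains the term log|S| h(ζ). If the differential were a linear map L plus a bounded one, then
log|S| h(ζ) plus the ε-average of L would be bounded uniformly in S and ε. Averaging over the signs
leaves only the diagonal of L (`norm_add_sum_diag_le`), which is bounded by the case of singletons;
so log|S| would be bounded. -/

noncomputable section

namespace Rochberg

/-! ### Taylor coefficients and multiplication by powers of z - c -/

section Taylor

variable {E : Type*} [NormedAddCommGroup E] [NormedSpace ℂ E]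

theorem taylorCoeff_zero (f : ℂ → E) (z : ℂ) : taylorCoeff f z 0 = f z := by
  simp [taylorCoeff]

theorem taylorCoeff_congr {f g : ℂ → E} {z : ℂ} (h : f =ᶠ[𝓝 z] g) (i : ℕ) :
    taylorCoeff f z i = taylorCoeff g z i := by
  simp only [taylorCoeff, (h.iteratedDeriv i).eq_of_nhds]

variable [CompleteSpace E]

theorem taylorCoeff_sub {f g : ℂ → E} {z : ℂ} (hf : AnalyticAt ℂ f z) (hg : AnalyticAt ℂ g z)
    (i : ℕ) : taylorCoeff (f - g) z i = taylorCoeff f z i - taylorCoeff g z i := by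
  have h : f - g = f + (-1 : ℂ) • g := by simp [sub_eq_add_neg]
  rw [h, taylorCoeff_add hf (hg.const_smul), taylorCoeff_smul hg]
  simp [sub_eq_add_neg]

/-- Leibniz's rule for a linear factor. It is stated on a neighbourhood, not just at c, so that the
induction can differentiate it. -/
theorem iteratedDeriv_succ_sub_smul {g : ℂ → E} {c : ℂ} (hg : AnalyticAt ℂ g c) (a : ℕ) :
    iteratedDeriv (a + 1) (fun z => (z - c) • g z) =ᶠ[𝓝 c]
      fun z => (z - c) • iteratedDeriv (a + 1) g z + ((a : ℂ) + 1) • iteratedDeriv a g z := by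
  induction a with
  | zero =>
    filter_upwards [hg.eventually_analyticAt] with z hz
    simp only [zero_add, iteratedDeriv_one, iteratedDeriv_zero]
    have h := ((hasDerivAt_id z).sub_const c).smul hz.differentiableAt.hasDerivAt
    exact h.deriv.trans (by simp)
  | succ a ih =>
    have h2 : AnalyticAt ℂ (iteratedDeriv a g) c := by
      rw [iteratedDeriv_eq_iterate]; exact hg.iterated_deriv a
    have h3 : AnalyticAt ℂ (iteratedDeriv (a + 1) g) c := by
      rw [iteratedDeriv_eq_iterate]; exact hg.iterated_deriv (a + 1)
    rw [iteratedDeriv_succ]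
    filter_upwards [ih.eventuallyEq_nhds, h2.eventually_analyticAt, h3.eventually_analyticAt]
      with z hz hz2 hz3
    rw [hz.deriv_eq]
    have e2 : HasDerivAt (iteratedDeriv a g) (iteratedDeriv (a + 1) g z) z := by
      rw [iteratedDeriv_succ]; exact hz2.differentiableAt.hasDerivAt
    have e3 : HasDerivAt (iteratedDeriv (a + 1) g) (iteratedDeriv (a + 1 + 1) g z) z := by
      rw [iteratedDeriv_succ (n := a + 1)]; exact hz3.differentiableAt.hasDerivAt
    have h := (((hasDerivAt_id z).sub_const c).smul e3).add (e2.const_smul ((a : ℂ) + 1))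
    refine h.deriv.trans ?_
    push_cast
    simp only [id]
    module

theorem taylorCoeff_sub_smul_succ {g : ℂ → E} {c : ℂ} (hg : AnalyticAt ℂ g c) (a : ℕ) :
    taylorCoeff (fun z => (z - c) • g z) c (a + 1) = taylorCoeff g c a := by
  have h := (iteratedDeriv_succ_sub_smul hg a).eq_of_nhds
  have h0 : ((a : ℂ) + 1) ≠ 0 := by exact_mod_cast a.succ_ne_zero
  simp only [taylorCoeff, h, sub_self, zero_smul, zero_add, smul_smul, Nat.factorial_succ]
  congr 1
  push_cast
  field_simp

theorem taylorCoeff_pow_smul_add {g : ℂ → E} {c : ℂ} (hg : AnalyticAt ℂ g c) (N b : ℕ) :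
    taylorCoeff (fun z => (z - c) ^ N • g z) c (N + b) = taylorCoeff g c b := by
  induction N with
  | zero => simp
  | succ N ih =>
    have h : (fun z => (z - c) ^ (N + 1) • g z) =
        fun z => (z - c) • ((z - c) ^ N • g z) := by
      funext z; rw [smul_smul, pow_succ']
    have h2 : AnalyticAt ℂ (fun z => (z - c) ^ N • g z) c := by fun_prop
    rw [h, show N + 1 + b = (N + b) + 1 by omega, taylorCoeff_sub_smul_succ h2, ih]

theorem taylorCoeff_pow_smul_of_lt {g : ℂ → E} {c : ℂ} (hg : AnalyticAt ℂ g c) {N i : ℕ}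
    (hi : i < N) : taylorCoeff (fun z => (z - c) ^ N • g z) c i = 0 := by
  have h2 : AnalyticAt ℂ (fun z => (z - c) ^ N • g z) c := by fun_prop
  have := (natCast_le_analyticOrderAt_iff_iteratedDeriv_eq_zero (n := N) h2).1
    ((natCast_le_analyticOrderAt h2).2 ⟨g, hg, Eventually.of_forall fun _ => rfl⟩) i hi
  simp [taylorCoeff, this]

theorem exists_eq_pow_smul {f : ℂ → E} {c : ℂ} (hf : AnalyticAt ℂ f c) {N : ℕ}
    (h : ∀ i < N, taylorCoeff f c i = 0) :
    ∃ g : ℂ → E, AnalyticAt ℂ g c ∧ f =ᶠ[𝓝 c] fun z => (z - c) ^ N • g z := by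
  refine (natCast_le_analyticOrderAt hf).1
    ((natCast_le_analyticOrderAt_iff_iteratedDeriv_eq_zero hf).2 fun i hi => ?_)
  simpa [taylorCoeff, Nat.factorial_ne_zero] using h i hi

theorem taylorCoeff_const_add_pow_smul {g : ℂ → E} {c : ℂ} (hg : AnalyticAt ℂ g c) (x : E)
    {N i : ℕ} (hi : 0 < i) (hN : i < N) :
    taylorCoeff (fun z => x + (z - c) ^ N • g z) c i = 0 := by
  have h2 : AnalyticAt ℂ (fun z => (z - c) ^ N • g z) c := by fun_prop
  have h := taylorCoeff_add (f := fun _ => x) analyticAt_const h2 i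
  rw [taylorCoeff_pow_smul_of_lt hg hN] at h
  refine h.trans ?_
  simp [taylorCoeff, iteratedDeriv_const, hi.ne']

theorem clm_taylorCoeff {F : Type*} [NormedAddCommGroup F] [NormedSpace ℂ F] (T : E →L[ℂ] F)
    {f : ℂ → E} {c : ℂ} (hf : AnalyticAt ℂ f c) (i : ℕ) :
    T (taylorCoeff f c i) = taylorCoeff (fun z => T (f z)) c i := by
  have h := T.iteratedFDeriv_comp_left (n := i) (hf.contDiffAt (n := i)) le_rfl
  simp only [taylorCoeff, map_smul, iteratedDeriv_eq_iteratedFDeriv]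
  congr 1
  have h2 : iteratedFDeriv ℂ i (fun z => T (f z)) c = _ := h
  rw [h2]
  rfl

/-- Cauchy's estimate; what matters is that the constant does not depend on f. -/
theorem norm_taylorCoeff_le {c : ℂ} (hc : c ∈ disc) (i : ℕ) :
    ∃ C : ℝ, 0 ≤ C ∧ ∀ (f : ℂ → E) (M : ℝ), DifferentiableOn ℂ f disc →
      (∀ z ∈ disc, ‖f z‖ ≤ M) → ‖taylorCoeff f c i‖ ≤ C * M := by
  obtain ⟨R, hR, hsub⟩ := Metric.nhds_basis_closedBall.mem_iff.1 (Metric.isOpen_ball.mem_nhds hc)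
  refine ⟨1 / R ^ i, by positivity, fun f M hf hM => ?_⟩
  have h := Complex.norm_iteratedDeriv_le_of_forall_mem_sphere_norm_le (C := M) i hR
    (f := f) (c := c) ?_ ?_
  · have h0 : (0 : ℝ) < i.factorial := by positivity
    rw [taylorCoeff, norm_smul, norm_inv, Complex.norm_natCast]
    calc (i.factorial : ℝ)⁻¹ * ‖iteratedDeriv i f c‖
        ≤ (i.factorial : ℝ)⁻¹ * (i.factorial * M / R ^ i) := by gcongr
      _ = 1 / R ^ i * M := by field_simp
  · refine DifferentiableOn.diffContOnCl (hf.mono ?_)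
    exact (closure_minimal Metric.ball_subset_closedBall Metric.isClosed_closedBall).trans hsub
  · exact fun z hz => hM z (hsub (Metric.sphere_subset_closedBall hz))

end Taylor

/-! ### The ℓ_p norm by duality, uniformly in the exponent -/

section SequenceNorm

theorem lpNorm_top_le_iff {R : ℝ} (hR : 0 ≤ R) (x : LInf) :
    lpNorm ∞ x ≤ ENNReal.ofReal R ↔ ∀ i, ‖x i‖ ≤ R := by
  rw [lpNorm, eLpNorm_exponent_top, eLpNormEssSup_count, iSup_le_iff]
  refine forall_congr' fun i => ?_
  rw [← ofReal_norm, ENNReal.ofReal_le_ofReal_iff hR]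

theorem lpNorm_le_iff_sum_rpow {θ R : ℝ} (hθ : 0 < θ) (hR : 0 ≤ R) (x : LInf) :
    lpNorm (ENNReal.ofReal θ)⁻¹ x ≤ ENNReal.ofReal R ↔
      ∀ S : Finset ℕ, ∑ i ∈ S, ‖x i‖ ^ θ⁻¹ ≤ R ^ θ⁻¹ := by
  have h0 : (ENNReal.ofReal θ)⁻¹ ≠ 0 := ENNReal.inv_ne_zero.2 ENNReal.ofReal_ne_top
  have h1 : (ENNReal.ofReal θ)⁻¹ ≠ ∞ :=
    ENNReal.inv_ne_top.2 (ENNReal.ofReal_pos.2 hθ).ne'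
  have h2 : ((ENNReal.ofReal θ)⁻¹).toReal = θ⁻¹ := by
    rw [ENNReal.toReal_inv, ENNReal.toReal_ofReal hθ.le]
  have hi : 0 < θ⁻¹ := inv_pos.2 hθ
  rw [lpNorm, eLpNorm_eq_lintegral_rpow_enorm_toReal h0 h1, h2, lintegral_count, one_div,
    ENNReal.rpow_inv_le_iff hi, ENNReal.tsum_eq_iSup_sum, iSup_le_iff]
  refine forall_congr' fun S => ?_
  have h3 : ∑ i ∈ S, ‖x i‖ₑ ^ θ⁻¹ = ENNReal.ofReal (∑ i ∈ S, ‖x i‖ ^ θ⁻¹) := by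
    rw [ENNReal.ofReal_sum_of_nonneg fun i _ => by positivity]
    refine Finset.sum_congr rfl fun i _ => ?_
    rw [← ofReal_norm, ENNReal.ofReal_rpow_of_nonneg (norm_nonneg _) hi.le]
  rw [h3, ENNReal.ofReal_rpow_of_nonneg hR hi.le, ENNReal.ofReal_le_ofReal_iff (by positivity)]

/-- Hölder's inequality, from the weighted arithmetic-geometric mean inequality in each term. It
also covers the endpoints θ = 0 and θ = 1, which occur on the circle. -/
theorem sum_rpow_mul_rpow_le_one {θ : ℝ} (hθ : 0 ≤ θ) (hθ1 : θ ≤ 1) {S : Finset ℕ} {a b : ℕ → ℝ}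
    (ha : ∀ i, 0 ≤ a i) (hb : ∀ i, 0 ≤ b i) (hsa : ∑ i ∈ S, a i ≤ 1) (hsb : ∑ i ∈ S, b i ≤ 1) :
    ∑ i ∈ S, a i ^ θ * b i ^ (1 - θ) ≤ 1 := by
  calc ∑ i ∈ S, a i ^ θ * b i ^ (1 - θ) ≤ ∑ i ∈ S, (θ * a i + (1 - θ) * b i) := by
        gcongr with i
        exact Real.geom_mean_le_arith_mean2_weighted hθ (sub_nonneg.2 hθ1) (ha i) (hb i) (by ring)
    _ = θ * ∑ i ∈ S, a i + (1 - θ) * ∑ i ∈ S, b i := by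
        rw [Finset.sum_add_distrib, Finset.mul_sum, Finset.mul_sum]
    _ ≤ θ * 1 + (1 - θ) * 1 := by
        have := sub_nonneg.2 hθ1
        gcongr
    _ = 1 := by ring

/-- The `ℓ_p` norm is given by duality; this form is uniform in the exponent `p = 1 / θ`. -/
theorem lpNorm_le_iff {θ R : ℝ} (hθ : 0 ≤ θ) (hθ1 : θ ≤ 1) (hR : 0 ≤ R) (x : LInf) :
    lpNorm (ENNReal.ofReal θ)⁻¹ x ≤ ENNReal.ofReal R ↔
      ∀ (S : Finset ℕ) (b : ℕ → ℝ), (∀ i, 0 ≤ b i) → ∑ i ∈ S, b i ≤ 1 →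
        ∑ i ∈ S, ‖x i‖ * b i ^ (1 - θ) ≤ R := by
  rcases hθ.eq_or_lt with rfl | hθ
  · rw [ENNReal.ofReal_zero, ENNReal.inv_zero, lpNorm_top_le_iff hR]
    simp only [sub_zero, Real.rpow_one]
    refine ⟨fun h S b hb hs => ?_, fun h i => ?_⟩
    · calc ∑ i ∈ S, ‖x i‖ * b i ≤ ∑ i ∈ S, R * b i := by
            gcongr with i
            · exact hb i
            · exact h i
        _ = R * ∑ i ∈ S, b i := by rw [Finset.mul_sum]
        _ ≤ R * 1 := by gcongr
        _ = R := mul_one R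
    · simpa using h {i} (fun _ => 1) (fun _ => zero_le_one) (by simp)
  · rw [lpNorm_le_iff_sum_rpow hθ hR]
    have hi : 0 < θ⁻¹ := inv_pos.2 hθ
    refine ⟨fun h S b hb hs => ?_, fun h S => ?_⟩
    · rcases hR.eq_or_lt with rfl | hR
      · refine Finset.sum_nonpos fun i _ => ?_
        have := h {i}
        rw [Real.zero_rpow hi.ne', Finset.sum_singleton] at this
        have h4 := (Real.rpow_eq_zero (norm_nonneg _) hi.ne').1
          (this.antisymm (by positivity))
        simp [h4]
      · have h5 := sum_rpow_mul_rpow_le_one hθ.le hθ1 (S := S) (a := fun i => (‖x i‖ / R) ^ θ⁻¹)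
          (fun i => by positivity) hb ?_ hs
        · calc ∑ i ∈ S, ‖x i‖ * b i ^ (1 - θ)
              = R * ∑ i ∈ S, ((‖x i‖ / R) ^ θ⁻¹) ^ θ * b i ^ (1 - θ) := by
                rw [Finset.mul_sum]
                refine Finset.sum_congr rfl fun i _ => ?_
                rw [Real.rpow_inv_rpow (by positivity) hθ.ne']
                field_simp
            _ ≤ R * 1 := by gcongr
            _ = R := mul_one R
        · have : ∀ i ∈ S, (‖x i‖ / R) ^ θ⁻¹ = ‖x i‖ ^ θ⁻¹ / R ^ θ⁻¹ := fun i _ =>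
            Real.div_rpow (norm_nonneg _) hR.le _
          rw [Finset.sum_congr rfl this, ← Finset.sum_div]
          exact div_le_one_of_le₀ (h S) (by positivity)
    · set T := ∑ i ∈ S, ‖x i‖ ^ θ⁻¹ with hT
      have hT0 : 0 ≤ T := Finset.sum_nonneg fun i _ => by positivity
      rcases hT0.eq_or_lt with hT1 | hT1
      · rw [← hT1]; positivity
      -- The case of equality in Hölder's inequality: testing with this b gives T^θ ≤ R.
      · have h6 := h S (fun i => ‖x i‖ ^ θ⁻¹ / T) (fun i => by positivity)
          (by rw [← Finset.sum_div, div_self hT1.ne'])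
        have h7 : ∀ i ∈ S, ‖x i‖ * (‖x i‖ ^ θ⁻¹ / T) ^ (1 - θ) = ‖x i‖ ^ θ⁻¹ * T ^ (θ - 1) := by
          intro i _
          rw [Real.div_rpow (by positivity) hT0, ← Real.rpow_mul (norm_nonneg _),
            show θ - 1 = -(1 - θ) by ring, Real.rpow_neg hT0, div_eq_mul_inv, ← mul_assoc]
          congr 1
          rcases (norm_nonneg (x i)).eq_or_lt with h8 | h8
          · rw [← h8, zero_mul, Real.zero_rpow hi.ne']
          · nth_rw 1 [← Real.rpow_one ‖x i‖]
            rw [← Real.rpow_add h8]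
            congr 1
            field_simp
            ring
        rw [Finset.sum_congr rfl h7, ← Finset.sum_mul, ← hT] at h6
        have h9 : T * T ^ (θ - 1) = T ^ θ := by
          nth_rw 1 [← Real.rpow_one T]
          rw [← Real.rpow_add hT1]
          congr 1
          ring
        rw [h9] at h6
        rw [← Real.rpow_rpow_inv hT0 hθ.ne']
        exact Real.rpow_le_rpow (by positivity) h6 hi.le

theorem norm_le_of_lpNorm_le {θ R : ℝ} (hθ : 0 ≤ θ) (hθ1 : θ ≤ 1) (hR : 0 ≤ R) {x : LInf}
    (h : lpNorm (ENNReal.ofReal θ)⁻¹ x ≤ ENNReal.ofReal R) : ‖x‖ ≤ R := by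
  refine lp.norm_le_of_forall_le hR fun i => ?_
  simpa using (lpNorm_le_iff hθ hθ1 hR x).1 h {i} (fun _ => 1) (fun _ => zero_le_one) (by simp)

end SequenceNorm

/-! ### Conformal self-maps of the disc extend to the circle with modulus 1 -/

section Conformal

theorem exists_lt_of_pos_on_sphere {h : ℂ → ℝ} (hc : ContinuousOn h (Metric.closedBall 0 1))
    (hpos : ∀ z ∈ Metric.sphere (0 : ℂ) 1, 0 < h z) :
    ∃ s < 1, ∀ z ∈ Metric.closedBall (0 : ℂ) 1, s < ‖z‖ → 0 < h z := by
  have hK : IsCompact (Metric.closedBall (0 : ℂ) 1 ∩ h ⁻¹' Iic 0) :=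
    (isCompact_closedBall _ _).of_isClosed_subset
      (hc.preimage_isClosed_of_isClosed Metric.isClosed_closedBall isClosed_Iic) inter_subset_left
  rcases (Metric.closedBall (0 : ℂ) 1 ∩ h ⁻¹' Iic 0).eq_empty_or_nonempty with he | hne
  · refine ⟨0, zero_lt_one, fun z hz _ => ?_⟩
    by_contra hh
    exact (he ▸ (⟨hz, not_lt.1 hh⟩ : z ∈ Metric.closedBall (0 : ℂ) 1 ∩ h ⁻¹' Iic 0) :
      z ∈ (∅ : Set ℂ))
  · obtain ⟨w, hw, hmax⟩ := hK.exists_isMaxOn hne continuous_norm.continuousOn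
    refine ⟨‖w‖, ?_, fun z hz hzw => ?_⟩
    · refine lt_of_le_of_ne (by simpa using hw.1) fun hw1 => ?_
      exact (hpos w (by simpa using hw1)).not_ge hw.2
    · by_contra hh
      exact hzw.not_ge (hmax ⟨hz, not_lt.1 hh⟩)

/-- Boundary values need not exist: the maximum principle is applied on discs of radius r < 1 close
to 1. -/
theorem norm_le_one_of_boundary {h : ℂ → ℂ} (hd : DifferentiableOn ℂ h disc)
    (hb : ∀ C > 1, ∃ s < 1, ∀ z ∈ disc, s < ‖z‖ → ‖h z‖ ≤ C) {z : ℂ} (hz : z ∈ disc) :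
    ‖h z‖ ≤ 1 := by
  refine le_of_forall_gt_imp_ge_of_dense fun C hC => ?_
  obtain ⟨s, hs, hsb⟩ := hb C hC
  have hz1 : ‖z‖ < 1 := by simpa using hz
  obtain ⟨r, hr, hr1⟩ := exists_between (max_lt hs hz1)
  have hzr := (le_max_right _ _).trans_lt hr
  have hr0 : r ≠ 0 := ((norm_nonneg z).trans_lt hzr).ne'
  have hcl : closure (Metric.ball (0 : ℂ) r) ⊆ disc := by
    rw [closure_ball _ hr0]; exact Metric.closedBall_subset_ball hr1
  refine Complex.norm_le_of_forall_mem_frontier_norm_le (U := Metric.ball 0 r)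
    Metric.isBounded_ball (hd.mono hcl).diffContOnCl (fun w hw => ?_)
    (subset_closure (by simpa using hzr))
  rw [frontier_ball _ hr0] at hw
  have hw' : ‖w‖ = r := by simpa using hw
  exact hsb w (by simpa [hw'] using hr1) (by rw [hw']; exact (le_max_left _ _).trans_lt hr)

theorem IsConformalEquiv.analyticOnNhd {φ : ℂ → ℂ} (h : IsConformalEquiv disc φ) :
    AnalyticOnNhd ℂ φ disc := h.1.analyticOnNhd Metric.isOpen_ball

/-- A conformal self-map is proper: its inverse is continuous, so the preimage of a closed disc of
radius r < 1 is compact and stays away from the circle. -/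
theorem IsConformalEquiv.exists_lt_norm {φ : ℂ → ℂ} (h : IsConformalEquiv disc φ) {r : ℝ}
    (hr : r < 1) : ∃ s < 1, ∀ z ∈ disc, s < ‖z‖ → r < ‖φ z‖ := by
  -- Open mapping theorem, φ being nonconstant by injectivity; it makes the inverse `g` continuous.
  have hopen : ∀ s ⊆ disc, IsOpen s → IsOpen (φ '' s) := by
    refine (h.analyticOnNhd.is_constant_or_isOpen
      (convex_ball (0 : ℂ) 1).isPreconnected).resolve_left ?_
    rintro ⟨w, hw⟩
    have h1 : φ 0 = φ (1 / 2) := by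
      rw [hw 0 (by simp), hw (1 / 2) (by simp; norm_num)]
    have := h.2.injOn (show (0 : ℂ) ∈ disc by simp)
      (show (1 / 2 : ℂ) ∈ disc by simp; norm_num) h1
    norm_num at this
  set g := Function.invFunOn φ disc
  have hgl : ∀ z ∈ disc, g (φ z) = z := fun z hz => h.2.injOn.leftInvOn_invFunOn hz
  have hg : ContinuousOn g disc := by
    intro w hw
    obtain ⟨z, hz, rfl⟩ := h.2.surjOn hw
    refine ContinuousAt.continuousWithinAt ?_
    rw [ContinuousAt, hgl z hz]
    intro V hV
    obtain ⟨U, hUV, hU, hzU⟩ := mem_nhds_iff.1 (inter_mem hV (Metric.isOpen_ball.mem_nhds hz))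
    refine mem_map.2 (mem_of_superset ((hopen U (hUV.trans inter_subset_right) hU).mem_nhds
      (mem_image_of_mem φ hzU)) ?_)
    rintro _ ⟨u, hu, rfl⟩
    rw [mem_preimage, hgl u (hUV hu).2]
    exact (hUV hu).1
  have hK : IsCompact (g '' Metric.closedBall 0 r) :=
    (isCompact_closedBall _ _).image_of_continuousOn (hg.mono (Metric.closedBall_subset_ball hr))
  have hKd : g '' Metric.closedBall 0 r ⊆ disc := by
    rintro _ ⟨w, hw, rfl⟩
    obtain ⟨z, hz, rfl⟩ := h.2.surjOn (Metric.closedBall_subset_ball hr hw)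
    rwa [hgl z hz]
  have key : ∀ z ∈ disc, ¬ r < ‖φ z‖ → z ∈ g '' Metric.closedBall 0 r := fun z hz hh =>
    ⟨φ z, by simpa using hh, hgl z hz⟩
  rcases (g '' Metric.closedBall 0 r).eq_empty_or_nonempty with he | hne
  · refine ⟨0, zero_lt_one, fun z hz _ => ?_⟩
    by_contra hh
    have := key z hz hh
    simp [he] at this
  · obtain ⟨w, hw, hmax⟩ := hK.exists_isMaxOn hne continuous_norm.continuousOn
    refine ⟨‖w‖, by simpa using hKd hw, fun z hz hzw => ?_⟩
    by_contra hh
    exact hzw.not_ge (hmax (key z hz hh))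

theorem one_sub_conj_mul_ne_zero {a z : ℂ} (ha : a ∈ disc) (hz : z ∈ Metric.closedBall (0 : ℂ) 1) :
    1 - (starRingEnd ℂ) a * z ≠ 0 := by
  intro h
  have h1 : ‖(starRingEnd ℂ) a * z‖ = 1 := by rw [← sub_eq_zero.1 h, norm_one]
  rw [norm_mul, RCLike.norm_conj] at h1
  have h2 : ‖a‖ < 1 := by simpa using ha
  have h3 : ‖z‖ ≤ 1 := by simpa using hz
  nlinarith [norm_nonneg a, norm_nonneg z]

theorem norm_sub_div_one_sub_conj_mul {a z : ℂ} (ha : a ∈ disc) (hz : ‖z‖ = 1) :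
    ‖(z - a) / (1 - (starRingEnd ℂ) a * z)‖ = 1 := by
  have h0 := one_sub_conj_mul_ne_zero ha (z := z) (by simp [hz])
  have h1 : 1 - (starRingEnd ℂ) a * z = z * (starRingEnd ℂ) (z - a) := by
    have : z * (starRingEnd ℂ) z = 1 := by rw [Complex.mul_conj']; simp [hz]
    rw [map_sub, mul_sub, this]
    ring
  rw [norm_div, h1, norm_mul, RCLike.norm_conj, hz, one_mul, div_self]
  intro h2
  refine h0 ?_
  rw [h1, norm_eq_zero.1 h2, map_zero, mul_zero]

/-- Dividing φ by a power B^M of the Blaschke factor at its zero a leaves a function v without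
zeros. Near the circle both |v| and 1/|v| are at most C, for each C > 1, so v is a unimodular
constant and B^M v(0) is the extension. That M = 1 is not needed. -/
theorem IsConformalEquiv.exists_extension {φ : ℂ → ℂ} (h : IsConformalEquiv disc φ) :
    ∃ ψ : ℂ → ℂ, ContinuousOn ψ (Metric.closedBall 0 1) ∧ EqOn φ ψ disc ∧
      ∀ z ∈ Metric.sphere (0 : ℂ) 1, ‖ψ z‖ = 1 := by
  obtain ⟨a, ha, hφa⟩ := h.2.surjOn (show (0 : ℂ) ∈ disc by simp)
  have hφ0 : ∀ z ∈ disc, z ≠ a → φ z ≠ 0 := fun z hz hza h0 =>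
    hza (h.2.injOn hz ha (h0.trans hφa.symm))
  have han := h.analyticOnNhd a ha
  have htop : analyticOrderAt φ a ≠ ⊤ := by
    rw [Ne, analyticOrderAt_eq_top]
    intro h0
    have h1 : ∀ᶠ z in 𝓝[≠] a, φ z = 0 ∧ z ∈ disc :=
      ((h0.and (Metric.isOpen_ball.mem_nhds ha)).filter_mono nhdsWithin_le_nhds)
    obtain ⟨z, hz, hza⟩ := (h1.and self_mem_nhdsWithin).exists
    exact hφ0 z hz.2 hza hz.1
  obtain ⟨g, hg, hga, hφg⟩ := han.analyticOrderAt_ne_top.1 htop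
  set M := analyticOrderNatAt φ a
  set D : ℂ → ℂ := fun z => 1 - (starRingEnd ℂ) a * z
  set B : ℂ → ℂ := fun z => (z - a) / D z
  have hD : ∀ z ∈ Metric.closedBall (0 : ℂ) 1, D z ≠ 0 := fun z hz =>
    one_sub_conj_mul_ne_zero ha hz
  have hBc : ContinuousOn B (Metric.closedBall 0 1) :=
    ContinuousOn.div (by fun_prop) (by fun_prop) hD
  have hB1 : ∀ z ∈ Metric.sphere (0 : ℂ) 1, ‖B z‖ = 1 := fun z hz =>
    norm_sub_div_one_sub_conj_mul ha (by simpa using hz)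
  set u : ℂ → ℂ := fun z => if z = a then g a else φ z / (z - a) ^ M with hu
  have hug : u =ᶠ[𝓝 a] g := by
    filter_upwards [hφg] with z hz
    by_cases hza : z = a
    · simp [hu, hza]
    · have : (z - a) ^ M ≠ 0 := pow_ne_zero _ (sub_ne_zero.2 hza)
      simp only [hu, hza, if_false, hz, smul_eq_mul]
      field_simp
  have hφu : ∀ z, z ∈ disc → φ z = (z - a) ^ M * u z := by
    intro z hz
    by_cases hza : z = a
    · subst hza
      have h1 : u z = g z := by simp [hu]
      rw [h1]; simpa using hφg.self_of_nhds
    · have : (z - a) ^ M ≠ 0 := pow_ne_zero _ (sub_ne_zero.2 hza)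
      simp only [hu, hza, if_false]
      field_simp
  have hud : DifferentiableOn ℂ u disc := by
    intro z hz
    refine DifferentiableAt.differentiableWithinAt ?_
    by_cases hza : z = a
    · subst hza
      exact hug.differentiableAt_iff.2 hg.differentiableAt
    · have h1 : u =ᶠ[𝓝 z] fun z => φ z / (z - a) ^ M := by
        filter_upwards [isOpen_ne.mem_nhds hza] with w hw
        simp only [hu, if_neg (show w ≠ a from hw)]
      refine h1.differentiableAt_iff.2 ?_
      refine DifferentiableAt.div ((h.analyticOnNhd z hz).differentiableAt) (by fun_prop)
        (pow_ne_zero _ (sub_ne_zero.2 hza))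
  have hu0 : ∀ z ∈ disc, u z ≠ 0 := by
    intro z hz h0
    by_cases hza : z = a
    · subst hza
      exact hga (by simpa [hu] using h0)
    · exact hφ0 z hz hza (by rw [hφu z hz, h0, mul_zero])
  set v : ℂ → ℂ := fun z => u z * D z ^ M with hv
  have hvd : DifferentiableOn ℂ v disc := hud.mul (by fun_prop)
  have hsub : disc ⊆ Metric.closedBall (0 : ℂ) 1 := Metric.ball_subset_closedBall
  have hv0 : ∀ z ∈ disc, v z ≠ 0 := fun z hz =>
    mul_ne_zero (hu0 z hz) (pow_ne_zero _ (hD z (hsub hz)))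
  have hφv : ∀ z ∈ disc, φ z = B z ^ M * v z := by
    intro z hz
    have h1 := pow_ne_zero M (hD z (hsub hz))
    simp only [hφu z hz, hv, B, div_pow]
    field_simp
  have hφle : ∀ z ∈ disc, ‖φ z‖ < 1 := fun z hz => by simpa using h.2.mapsTo hz
  have hv1 : ∀ z ∈ disc, ‖v z‖ ≤ 1 := by
    refine fun z hz => norm_le_one_of_boundary hvd (fun C hC => ?_) hz
    obtain ⟨s, hs, hsB⟩ := exists_lt_of_pos_on_sphere (h := fun z => C * ‖B z‖ ^ M - 1)
      ((continuousOn_const.mul (hBc.norm.pow M)).sub continuousOn_const)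
      (fun z hz => by rw [hB1 z hz]; simpa using hC)
    refine ⟨s, hs, fun z hz hsz => ?_⟩
    have h1 := hsB z (hsub hz) hsz
    have h2 := hφle z hz
    rw [hφv z hz, norm_mul, norm_pow] at h2
    have h3 : 0 < ‖B z‖ ^ M := by
      by_contra h3
      nlinarith
    by_contra h4
    nlinarith
  have hv2 : ∀ z ∈ disc, ‖(v z)⁻¹‖ ≤ 1 := by
    refine fun z hz => norm_le_one_of_boundary (h := fun z => (v z)⁻¹) (hvd.inv hv0)
      (fun C hC => ?_) hz
    -- Near the circle |B|^M < q, and |φ| > q/C by properness; together they give |v| > 1/C.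
    obtain ⟨q, hq, hqC⟩ := exists_between hC
    have hq0 : 0 < q := zero_lt_one.trans hq
    obtain ⟨s, hs, hsB⟩ := exists_lt_of_pos_on_sphere (h := fun z => q - ‖B z‖ ^ M)
      (continuousOn_const.sub (hBc.norm.pow M))
      (fun z hz => by rw [hB1 z hz]; simpa using hq)
    obtain ⟨s', hs', hsφ⟩ := h.exists_lt_norm (r := q / C)
      ((div_lt_one (zero_lt_one.trans hC)).2 hqC)
    refine ⟨max s s', max_lt hs hs', fun z hz hsz => ?_⟩
    have h1 := hsB z (hsub hz) ((le_max_left _ _).trans_lt hsz)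
    have h2 := hsφ z hz ((le_max_right _ _).trans_lt hsz)
    rw [hφv z hz, norm_mul, norm_pow, div_lt_iff₀ (zero_lt_one.trans hC)] at h2
    have h3 : 0 < ‖v z‖ := norm_pos_iff.2 (hv0 z hz)
    rw [norm_inv, inv_le_comm₀ h3 (zero_lt_one.trans hC), inv_le_iff_one_le_mul₀
      (zero_lt_one.trans hC)]
    by_contra h4
    have h5 : ‖B z‖ ^ M * (‖v z‖ * C) ≤ ‖B z‖ ^ M * 1 := by
      gcongr
      exact (not_le.1 h4).le
    linarith
  have hveq : ∀ z ∈ disc, ‖v z‖ = 1 := by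
    intro z hz
    refine (hv1 z hz).antisymm ?_
    have := hv2 z hz
    rw [norm_inv] at this
    exact (inv_le_one₀ (norm_pos_iff.2 (hv0 z hz))).1 this
  have h0d : (0 : ℂ) ∈ disc := by simp
  have hconst : EqOn v (Function.const ℂ (v 0)) disc :=
    Complex.eq_const_of_exists_max hvd h0d fun z hz => by
      simp only [mem_ofPred_eq, Function.comp, hveq z hz, hveq 0 h0d, le_refl]
  refine ⟨fun z => B z ^ M * v 0, (hBc.pow M).mul continuousOn_const, fun z hz => ?_,
    fun z hz => ?_⟩
  · rw [hφv z hz, hconst hz]; rfl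
  · rw [norm_mul, norm_pow, hB1 z hz, hveq 0 h0d]; simp

end Conformal

/-! ### Maximum principle for the varying norms; multiplication and division in 𝒵[ω] -/

section Extension

theorem disc_subset_closedBall : disc ⊆ Metric.closedBall (0 : ℂ) 1 := Metric.ball_subset_closedBall

/-- The `i`-th coordinate functional of `ℓ_∞`. -/
abbrev coord (i : ℕ) : LInf →L[ℂ] ℂ := lp.evalCLM ℂ (fun _ : ℕ => ℂ) ∞ i

theorem coord_apply (i : ℕ) (x : LInf) : coord i x = x i := rfl

theorem Config.re_mem_Icc (ω : Config) {z : ℂ} (hz : z ∈ Metric.closedBall (0 : ℂ) 1) :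
    (ω.toFun z).re ∈ Icc (0 : ℝ) 1 := by
  have h2 : ContinuousOn (fun w => (ω.toFun w).re) (closure disc) := by
    rw [closure_ball (0 : ℂ) one_ne_zero]
    exact Complex.continuous_re.comp_continuousOn ω.analytic.continuousOn
  have h1 : z ∈ closure disc := by rwa [closure_ball (0 : ℂ) one_ne_zero]
  refine closure_minimal (s := (fun w => (ω.toFun w).re) '' disc) ?_ isClosed_Icc
    (h2.image_closure (mem_image_of_mem _ h1))
  rintro _ ⟨w, hw, rfl⟩
  exact ⟨(ω.mapsTo hw).1.le, (ω.mapsTo hw).2.le⟩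

theorem Config.lpNorm_le_iff (ω : Config) {z : ℂ} (hz : z ∈ Metric.closedBall (0 : ℂ) 1) {R : ℝ}
    (hR : 0 ≤ R) (x : LInf) : lpNorm (ω.p z) x ≤ ENNReal.ofReal R ↔
      ∀ (S : Finset ℕ) (b : ℕ → ℝ), (∀ i, 0 ≤ b i) → ∑ i ∈ S, b i ≤ 1 →
        ∑ i ∈ S, ‖x i‖ * b i ^ (1 - (ω.toFun z).re) ≤ R :=
  Rochberg.lpNorm_le_iff (ω.re_mem_Icc hz).1 (ω.re_mem_Icc hz).2 hR x

theorem Config.continuousOn (ω : Config) : ContinuousOn ω.toFun (Metric.closedBall 0 1) :=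
  ω.analytic.continuousOn

theorem Config.differentiableOn (ω : Config) : DifferentiableOn ℂ ω.toFun disc :=
  ω.analytic.differentiableOn.mono disc_subset_closedBall

/-- The pairing of a sequence with `u_i b_i ^ (1 - ω(z))`, `i ∈ S`. -/
def pairing (ω : Config) (S : Finset ℕ) (b : ℕ → ℝ) (u : ℕ → ℂ) (z : ℂ) (x : LInf) : ℂ :=
  ∑ i ∈ S, u i * Complex.exp (Real.log (b i) * (1 - ω.toFun z)) * coord i x

theorem norm_exp_log_mul {b : ℝ} (hb : 0 < b) (w : ℂ) :
    ‖Complex.exp (Real.log b * w)‖ = b ^ w.re := by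
  rw [Complex.norm_exp, Real.rpow_def_of_pos hb]
  simp

/-- The coefficient b_i^(1-ω(z)) has modulus b_i^(1-Re ω(z)), the weight of the duality formula at
the exponent p(z). Thus one analytic family of functionals is contractive for all the norms at once.
-/
theorem norm_pairing_le (ω : Config) {S : Finset ℕ} {b : ℕ → ℝ} {u : ℕ → ℂ}
    (hb : ∀ i ∈ S, 0 < b i) (hs : ∑ i ∈ S, b i ≤ 1) (hu : ∀ i, ‖u i‖ = 1) {z : ℂ}
    (hz : z ∈ Metric.closedBall (0 : ℂ) 1) {R : ℝ} (hR : 0 ≤ R) {x : LInf}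
    (hx : lpNorm (ω.p z) x ≤ ENNReal.ofReal R) : ‖pairing ω S b u z x‖ ≤ R := by
  -- The duality formula asks for b ≥ 0 everywhere, whereas b is known to be positive on S only.
  have h := (ω.lpNorm_le_iff hz hR x).1 hx S (fun i => max (b i) 0) (fun i => le_max_right _ _) ?_
  · refine (norm_sum_le _ _).trans (le_trans (Finset.sum_le_sum fun i hi => ?_) h)
    rw [norm_mul, norm_mul, hu, one_mul, norm_exp_log_mul (hb i hi), max_eq_left (hb i hi).le,
      mul_comm]
    simp [coord_apply]
  · refine le_trans (Finset.sum_le_sum fun i hi => ?_) hs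
    rw [max_eq_left (hb i hi).le]

theorem continuousOn_pairing (ω : Config) (S : Finset ℕ) (b : ℕ → ℝ) (u : ℕ → ℂ)
    {F : ℂ → LInf} (hF : ContinuousOn F (Metric.closedBall 0 1)) :
    ContinuousOn (fun z => pairing ω S b u z (F z)) (Metric.closedBall 0 1) := by
  refine continuousOn_finsetSum _ fun i _ => ?_
  refine ContinuousOn.mul (continuousOn_const.mul ?_) ((coord i).continuous.comp_continuousOn hF)
  exact Complex.continuous_exp.comp_continuousOn
    (continuousOn_const.mul (continuousOn_const.sub ω.continuousOn))

theorem differentiableOn_pairing (ω : Config) (S : Finset ℕ) (b : ℕ → ℝ) (u : ℕ → ℂ)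
    {F : ℂ → LInf} (hF : DifferentiableOn ℂ F disc) :
    DifferentiableOn ℂ (fun z => pairing ω S b u z (F z)) disc := by
  refine DifferentiableOn.fun_sum fun i _ => ?_
  refine DifferentiableOn.mul (DifferentiableOn.const_mul ?_ _)
    ((coord i).differentiable.comp_differentiableOn hF)
  exact DifferentiableOn.cexp (((differentiableOn_const _).sub ω.differentiableOn).const_mul _)

theorem exists_norm_eq_one_mul_eq (w : ℂ) : ∃ u : ℂ, ‖u‖ = 1 ∧ u * w = ‖w‖ := by
  by_cases hw : w = 0
  · exact ⟨1, by simp, by simp [hw]⟩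
  · refine ⟨‖w‖ / w, by simp [hw], by field_simp⟩

/-- The maximum principle for the norms `‖·‖_{p(z)}`. -/
theorem lpNorm_le_of_sphere (ω : Config) {F : ℂ → LInf}
    (hc : ContinuousOn F (Metric.closedBall 0 1)) (hd : DifferentiableOn ℂ F disc) {R : ℝ}
    (hR : 0 ≤ R) (h : ∀ z ∈ Metric.sphere (0 : ℂ) 1, lpNorm (ω.p z) (F z) ≤ ENNReal.ofReal R)
    {z : ℂ} (hz : z ∈ Metric.closedBall (0 : ℂ) 1) : lpNorm (ω.p z) (F z) ≤ ENNReal.ofReal R := by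
  by_cases hz1 : z ∈ disc
  swap
  · refine h z ?_
    have h1 : ‖z‖ ≤ 1 := by simpa using hz
    have h2 : ¬ ‖z‖ < 1 := by simpa using hz1
    simpa using h1.antisymm (not_lt.1 h2)
  rw [ω.lpNorm_le_iff hz hR]
  intro S b hb hs
  have hθ : (ω.toFun z).re < 1 := (ω.mapsTo hz1).2
  -- Zero weights have no logarithm. They can be discarded since 1 - Re ω(z) > 0 inside the disc.
  set S' := S.filter fun i => 0 < b i
  have hS' : ∑ i ∈ S', ‖F z i‖ * b i ^ (1 - (ω.toFun z).re) =
      ∑ i ∈ S, ‖F z i‖ * b i ^ (1 - (ω.toFun z).re) := by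
    refine Finset.sum_filter_of_ne fun i _ hi => (hb i).lt_of_ne fun h0 => hi ?_
    rw [← h0, Real.zero_rpow (sub_pos.2 hθ).ne', mul_zero]
  have hb' : ∀ i ∈ S', 0 < b i := fun i hi => (Finset.mem_filter.1 hi).2
  have hs' : ∑ i ∈ S', b i ≤ 1 :=
    (Finset.sum_le_sum_of_subset_of_nonneg (Finset.filter_subset _ _) fun i _ _ => hb i).trans hs
  -- Phases making all summands of the pairing nonnegative at the given z; they stay fixed while the
  -- maximum principle is applied to the pairing.
  choose u hu huw using fun i => exists_norm_eq_one_mul_eq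
    (Complex.exp (Real.log (b i) * (1 - ω.toFun z)) * coord i (F z))
  have hmax := Complex.norm_le_of_forall_mem_frontier_norm_le (U := disc) (C := R) (z := z)
    (f := fun z => pairing ω S' b u z (F z)) Metric.isBounded_ball
    ⟨differentiableOn_pairing ω S' b u hd, by
      rw [closure_ball (0 : ℂ) one_ne_zero]; exact continuousOn_pairing ω S' b u hc⟩
    (fun w hw => by
      rw [frontier_ball (0 : ℂ) one_ne_zero] at hw
      exact norm_pairing_le ω hb' hs' hu (Metric.sphere_subset_closedBall hw) hR (h w hw))
    (subset_closure hz1)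
  have heq : pairing ω S' b u z (F z) =
      ((∑ i ∈ S', ‖F z i‖ * b i ^ (1 - (ω.toFun z).re) : ℝ) : ℂ) := by
    rw [pairing, Complex.ofReal_sum]
    refine Finset.sum_congr rfl fun i hi => ?_
    rw [mul_assoc, huw, norm_mul, norm_exp_log_mul (hb' i hi), mul_comm]
    simp [coord_apply]
  rw [← hS']
  refine (le_abs_self _).trans ?_
  rw [← Real.norm_eq_abs, ← Complex.norm_real, ← heq]
  exact hmax

theorem bdryExt_eq_of_continuousOn {f F : ℂ → LInf} (hc : ContinuousOn F (Metric.closedBall 0 1))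
    (heq : EqOn f F disc) {z : ℂ} (hz : z ∈ Metric.closedBall (0 : ℂ) 1) : bdryExt f z = F z := by
  refine extendFrom_eq (by rwa [closure_ball (0 : ℂ) one_ne_zero]) ?_
  refine ((hc z hz).mono disc_subset_closedBall).congr' ?_
  filter_upwards [self_mem_nhdsWithin] with w hw using (heq hw).symm

variable {ω : Config}

/-- By the maximum principle only the circle has to be checked. Explicitly constructed functions
enter the space this way. -/
theorem spaceZ_mem {f F : ℂ → LInf} {R : ℝ} (hR : 0 ≤ R)
    (hc : ContinuousOn F (Metric.closedBall 0 1)) (hd : DifferentiableOn ℂ F disc)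
    (heq : EqOn f F disc) (h0 : ∀ z ∉ disc, f z = 0)
    (h : ∀ z ∈ Metric.sphere (0 : ℂ) 1, lpNorm (ω.p z) (F z) ≤ ENNReal.ofReal R) :
    f ∈ (spaceZ ω).carrier ∧ (spaceZ ω).norm f ≤ R := by
  have hs : supNorm ω f ≤ ENNReal.ofReal R := iSup₂_le fun z hz => by
    rw [bdryExt_eq_of_continuousOn hc heq hz]
    exact lpNorm_le_of_sphere ω hc hd hR h hz
  refine ⟨⟨(hd.congr heq).analyticOnNhd Metric.isOpen_ball, h0,
    hc.congr fun z hz => bdryExt_eq_of_continuousOn hc heq hz,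
    hs.trans_lt ENNReal.ofReal_lt_top⟩, ENNReal.toReal_le_of_le_ofReal hR hs⟩

theorem spaceZ_continuousOn {f : ℂ → LInf} (hf : f ∈ (spaceZ ω).carrier) :
    ContinuousOn (bdryExt f) (Metric.closedBall 0 1) := hf.2.2.1

theorem spaceZ_eqOn {f : ℂ → LInf} (hf : f ∈ (spaceZ ω).carrier) : EqOn f (bdryExt f) disc :=
  fun _ hz => (extendFrom_eq (subset_closure hz) (hf.1.continuousOn _ hz)).symm

theorem spaceZ_differentiableOn {f : ℂ → LInf} (hf : f ∈ (spaceZ ω).carrier) :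
    DifferentiableOn ℂ f disc := hf.1.differentiableOn

theorem spaceZ_differentiableOn_bdryExt {f : ℂ → LInf} (hf : f ∈ (spaceZ ω).carrier) :
    DifferentiableOn ℂ (bdryExt f) disc :=
  hf.1.differentiableOn.congr (spaceZ_eqOn hf).symm

theorem spaceZ_norm_nonneg (f : ℂ → LInf) : 0 ≤ (spaceZ ω).norm f := ENNReal.toReal_nonneg

theorem spaceZ_lpNorm_le {f : ℂ → LInf} (hf : f ∈ (spaceZ ω).carrier) {z : ℂ}
    (hz : z ∈ Metric.closedBall (0 : ℂ) 1) :
    lpNorm (ω.p z) (bdryExt f z) ≤ ENNReal.ofReal ((spaceZ ω).norm f) := by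
  have h : lpNorm (ω.p z) (bdryExt f z) ≤ supNorm ω f :=
    le_iSup₂ (f := fun z (_ : z ∈ Metric.closedBall (0 : ℂ) 1) => lpNorm (ω.p z) (bdryExt f z)) z hz
  rwa [show (spaceZ ω).norm f = (supNorm ω f).toReal from rfl, ENNReal.ofReal_toReal hf.2.2.2.ne]

theorem spaceZ_lpNorm_apply_le {f : ℂ → LInf} (hf : f ∈ (spaceZ ω).carrier) {z : ℂ}
    (hz : z ∈ disc) : lpNorm (ω.p z) (f z) ≤ ENNReal.ofReal ((spaceZ ω).norm f) := by
  rw [spaceZ_eqOn hf hz]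
  exact spaceZ_lpNorm_le hf (disc_subset_closedBall hz)

theorem spaceZ_norm_bdryExt_le {f : ℂ → LInf} (hf : f ∈ (spaceZ ω).carrier) {z : ℂ}
    (hz : z ∈ Metric.closedBall (0 : ℂ) 1) : ‖bdryExt f z‖ ≤ (spaceZ ω).norm f :=
  norm_le_of_lpNorm_le (ω.re_mem_Icc hz).1 (ω.re_mem_Icc hz).2 (spaceZ_norm_nonneg f)
    (spaceZ_lpNorm_le hf hz)

theorem spaceZ_norm_apply_le {f : ℂ → LInf} (hf : f ∈ (spaceZ ω).carrier) {z : ℂ}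
    (hz : z ∈ disc) : ‖f z‖ ≤ (spaceZ ω).norm f := by
  rw [spaceZ_eqOn hf hz]
  exact spaceZ_norm_bdryExt_le hf (disc_subset_closedBall hz)

theorem spaceZ_norm_le {f : ℂ → LInf} (hf : f ∈ (spaceZ ω).carrier) {R : ℝ} (hR : 0 ≤ R)
    (h : ∀ z ∈ Metric.sphere (0 : ℂ) 1, lpNorm (ω.p z) (bdryExt f z) ≤ ENNReal.ofReal R) :
    (spaceZ ω).norm f ≤ R :=
  (spaceZ_mem hR (spaceZ_continuousOn hf) (spaceZ_differentiableOn_bdryExt hf) (spaceZ_eqOn hf)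
    hf.2.1 h).2

theorem lpNorm_smul_le {p : ℝ≥0∞} {c : ℂ} {C R : ℝ} (hc : ‖c‖ ≤ C) {x : LInf}
    (h : lpNorm p x ≤ ENNReal.ofReal R) : lpNorm p (c • x) ≤ ENNReal.ofReal (C * R) := by
  rw [lpNorm_smul, ENNReal.ofReal_mul ((norm_nonneg c).trans hc), ← ofReal_norm]
  gcongr

/-- Multiplication by a scalar function, continuous on the closed disc and analytic inside. -/
theorem spaceZ_mul_mem {f : ℂ → LInf} (hf : f ∈ (spaceZ ω).carrier) {φ ψ : ℂ → ℂ} {C : ℝ}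
    (hC : 0 ≤ C) (hψ : ContinuousOn ψ (Metric.closedBall 0 1)) (hd : DifferentiableOn ℂ φ disc)
    (heq : EqOn φ ψ disc) (hb : ∀ z ∈ Metric.sphere (0 : ℂ) 1, ‖ψ z‖ ≤ C) :
    (fun z => φ z • f z) ∈ (spaceZ ω).carrier ∧
      (spaceZ ω).norm (fun z => φ z • f z) ≤ C * (spaceZ ω).norm f := by
  refine spaceZ_mem (F := fun z => ψ z • bdryExt f z)
    (mul_nonneg hC (spaceZ_norm_nonneg f)) (hψ.smul (spaceZ_continuousOn hf))
    ((hd.congr heq.symm).smul (spaceZ_differentiableOn_bdryExt hf)) (fun z hz => ?_)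
    (fun z hz => ?_) (fun z hz => ?_)
  · simp only [heq hz, spaceZ_eqOn hf hz]
  · simp only [hf.2.1 z hz, smul_zero]
  · exact lpNorm_smul_le (hb z hz) (spaceZ_lpNorm_le hf (Metric.sphere_subset_closedBall hz))

/-- Division by a scalar function without zeros on the circle. -/
theorem spaceZ_mem_of_mul_mem {f : ℂ → LInf} (hf : DifferentiableOn ℂ f disc)
    (hf0 : ∀ z ∉ disc, f z = 0) {φ ψ : ℂ → ℂ} {C : ℝ} (hC : 0 ≤ C)
    (hψ : ContinuousOn ψ (Metric.closedBall 0 1)) (heq : EqOn φ ψ disc)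
    (hψ0 : ∀ z ∈ Metric.sphere (0 : ℂ) 1, ψ z ≠ 0)
    (hb : ∀ z ∈ Metric.sphere (0 : ℂ) 1, ‖(ψ z)⁻¹‖ ≤ C)
    (hφf : (fun z => φ z • f z) ∈ (spaceZ ω).carrier) :
    f ∈ (spaceZ ω).carrier ∧
      (spaceZ ω).norm f ≤ C * (spaceZ ω).norm (fun z => φ z • f z) := by
  classical
  set H := bdryExt (fun z => φ z • f z) with hH
  -- The candidate for the continuous extension. Near a point of the circle ψ ≠ 0, and both branches
  -- agree with ψ⁻¹ H, which is continuous there.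
  set F : ℂ → LInf := fun z => if z ∈ disc then f z else (ψ z)⁻¹ • H z with hF
  have hsph : ∀ z ∈ Metric.sphere (0 : ℂ) 1, z ∉ disc := fun z hz hzd => by
    have h1 : ‖z‖ = 1 := by simpa using hz
    have h2 : ‖z‖ < 1 := by simpa using hzd
    exact h2.ne h1
  have hfF : EqOn f F disc := fun z hz => by simp only [hF, if_pos hz]
  have hHF : ∀ z ∈ Metric.closedBall (0 : ℂ) 1, ψ z ≠ 0 → F z = (ψ z)⁻¹ • H z := by
    intro z hz hz0
    by_cases hzd : z ∈ disc
    · have h1 := spaceZ_eqOn hφf hzd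
      rw [← hH] at h1
      rw [← hfF hzd, ← h1, heq hzd, smul_smul, inv_mul_cancel₀ hz0, one_smul]
    · simp only [hF, if_neg hzd]
  refine spaceZ_mem (F := F) (mul_nonneg hC (spaceZ_norm_nonneg _)) (fun z hz => ?_)
    (hf.congr hfF.symm) hfF hf0 (fun z hz => ?_)
  · by_cases hzd : z ∈ disc
    · refine ContinuousAt.continuousWithinAt ?_
      refine ((hf.differentiableAt (Metric.isOpen_ball.mem_nhds hzd)).continuousAt).congr ?_
      filter_upwards [Metric.isOpen_ball.mem_nhds hzd] with w hw using hfF hw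
    · have hzs : z ∈ Metric.sphere (0 : ℂ) 1 := by
        have h1 : ‖z‖ ≤ 1 := by simpa using hz
        have h2 : ¬ ‖z‖ < 1 := by simpa using hzd
        simpa using h1.antisymm (not_lt.1 h2)
      have h1 : ContinuousWithinAt (fun w => (ψ w)⁻¹ • H w) (Metric.closedBall 0 1) z :=
        ((hψ z hz).inv₀ (hψ0 z hzs)).smul (spaceZ_continuousOn hφf z hz)
      refine h1.congr_of_eventuallyEq ?_ (hHF z hz (hψ0 z hzs))
      filter_upwards [(hψ z hz).eventually_ne (hψ0 z hzs), self_mem_nhdsWithin] with w hw hwb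
        using hHF w hwb hw
  · rw [hHF z (Metric.sphere_subset_closedBall hz) (hψ0 z hz)]
    exact lpNorm_smul_le (hb z hz) (spaceZ_lpNorm_le hφf (Metric.sphere_subset_closedBall hz))

end Extension

/-! ### Completeness and admissibility of 𝒵[ω] -/

section Admissible

theorem isConformalEquiv_id : IsConformalEquiv disc id :=
  ⟨differentiableOn_id, bijOn_id _⟩

theorem spaceZ_complete (ω : Config) (u : ℕ → ℂ → LInf) (hu : ∀ i, u i ∈ (spaceZ ω).carrier)
    (hcau : ∀ ε > 0, ∃ N, ∀ i ≥ N, ∀ j ≥ N, (spaceZ ω).norm (u i - u j) < ε) :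
    ∃ f ∈ (spaceZ ω).carrier, Tendsto (fun i => (spaceZ ω).norm (u i - f)) atTop (𝓝 0) := by
  classical
  have hext : ∀ i j, ∀ z ∈ Metric.closedBall (0 : ℂ) 1,
      bdryExt (u i - u j) z = bdryExt (u i) z - bdryExt (u j) z := fun i j z hz =>
    bdryExt_eq_of_continuousOn (F := fun z => bdryExt (u i) z - bdryExt (u j) z)
      ((spaceZ_continuousOn (hu i)).sub (spaceZ_continuousOn (hu j)))
      (fun w hw => by simp only [Pi.sub_apply, spaceZ_eqOn (hu i) hw, spaceZ_eqOn (hu j) hw]) hz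
  have hsubmem : ∀ i j, u i - u j ∈ (spaceZ ω).carrier := fun i j =>
    (spaceZ ω).carrier.sub_mem (hu i) (hu j)
  have hunif : UniformCauchySeqOn (fun i => bdryExt (u i)) atTop (Metric.closedBall 0 1) := by
    rw [Metric.uniformCauchySeqOn_iff]
    intro ε hε
    obtain ⟨N, hN⟩ := hcau ε hε
    refine ⟨N, fun i hi j hj z hz => ?_⟩
    rw [dist_eq_norm, ← hext i j z hz]
    exact (spaceZ_norm_bdryExt_le (hsubmem i j) hz).trans_lt (hN i hi j hj)
  have hpt : ∀ z, ∃ y, z ∈ Metric.closedBall (0 : ℂ) 1 →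
      Tendsto (fun i => bdryExt (u i) z) atTop (𝓝 y) := by
    intro z
    by_cases hz : z ∈ Metric.closedBall (0 : ℂ) 1
    · obtain ⟨y, hy⟩ := cauchySeq_tendsto_of_complete (hunif.cauchy_map hz)
      exact ⟨y, fun _ => hy⟩
    · exact ⟨0, fun h => absurd h hz⟩
  choose F hF using hpt
  have hFu : TendstoUniformlyOn (fun i => bdryExt (u i)) F atTop (Metric.closedBall 0 1) :=
    hunif.tendstoUniformlyOn_of_tendsto fun z hz => hF z hz
  have hFc : ContinuousOn F (Metric.closedBall 0 1) :=
    hFu.continuousOn (Frequently.of_forall fun i => spaceZ_continuousOn (hu i))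
  have hFd : DifferentiableOn ℂ F disc :=
    (hFu.mono disc_subset_closedBall).tendstoLocallyUniformlyOn.differentiableOn
      (Eventually.of_forall fun i => spaceZ_differentiableOn_bdryExt (hu i)) Metric.isOpen_ball
  set f : ℂ → LInf := fun z => if z ∈ disc then F z else 0 with hf
  have hfF : EqOn f F disc := fun z hz => by simp only [hf, if_pos hz]
  have hf0 : ∀ z ∉ disc, f z = 0 := fun z hz => by simp only [hf, if_neg hz]
  -- Differences are treated first; f lies in the space because f = u_N - (u_N - f).
  have key : ∀ (ε : ℝ), 0 < ε → ∃ N, ∀ i ≥ N,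
      u i - f ∈ (spaceZ ω).carrier ∧ (spaceZ ω).norm (u i - f) ≤ ε := by
    intro ε hε
    obtain ⟨N, hN⟩ := hcau ε hε
    refine ⟨N, fun i hi => ?_⟩
    refine spaceZ_mem (F := fun z => bdryExt (u i) z - F z) hε.le
      ((spaceZ_continuousOn (hu i)).sub hFc) ((spaceZ_differentiableOn_bdryExt (hu i)).sub hFd)
      (fun z hz => ?_) (fun z hz => ?_) (fun z hz => ?_)
    · simp only [Pi.sub_apply, spaceZ_eqOn (hu i) hz, hfF hz]
    · simp only [Pi.sub_apply, (hu i).2.1 z hz, hf0 z hz, sub_zero]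
    · have hz' := Metric.sphere_subset_closedBall hz
      rw [ω.lpNorm_le_iff hz' hε.le]
      intro S b hb hs
      -- The duality formula involves finite sums only, so bounds on ℓ_{p(z)} norms survive
      -- coordinatewise limits.
      have hlim : Tendsto (fun j => ∑ l ∈ S, ‖(bdryExt (u i) z - bdryExt (u j) z) l‖ *
          b l ^ (1 - (ω.toFun z).re)) atTop
          (𝓝 (∑ l ∈ S, ‖(bdryExt (u i) z - F z) l‖ * b l ^ (1 - (ω.toFun z).re))) := by
        refine tendsto_finsetSum _ fun l _ => Tendsto.mul_const _ (Tendsto.norm ?_)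
        exact (((coord l).continuous.tendsto _).comp (tendsto_const_nhds.sub (hF z hz')))
      refine le_of_tendsto hlim ?_
      filter_upwards [eventually_ge_atTop N] with j hj
      refine (ω.lpNorm_le_iff hz' hε.le _).1 ?_ S b hb hs
      rw [← hext i j z hz']
      exact (spaceZ_lpNorm_le (hsubmem i j) hz').trans
        (ENNReal.ofReal_le_ofReal (hN i hi j hj).le)
  refine ⟨f, ?_, ?_⟩
  · obtain ⟨N, hN⟩ := key 1 one_pos
    have := (spaceZ ω).carrier.sub_mem (hu N) (hN N le_rfl).1
    rwa [sub_sub_cancel] at this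
  · rw [Metric.tendsto_atTop]
    intro ε hε
    obtain ⟨N, hN⟩ := key (ε / 2) (half_pos hε)
    refine ⟨N, fun i hi => ?_⟩
    rw [Real.dist_0_eq_abs, abs_of_nonneg (spaceZ_norm_nonneg _)]
    exact (hN i hi).2.trans_lt (half_lt_self hε)

/-- Multiplication by a conformal φ preserves membership and norm because its extension ψ has
modulus 1 on the circle, where norms are determined; having no zeros there, ψ can also be divided
out. -/
theorem spaceZ_isAdmissible (ω : Config) : (spaceZ ω).IsAdmissible where
  isOpen := Metric.isOpen_ball
  conformal := ⟨id, isConformalEquiv_id⟩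
  norm_nonneg f _ := spaceZ_norm_nonneg f
  norm_eq_zero f hf := by
    refine ⟨fun h => funext fun z => ?_, ?_⟩
    · by_cases hz : z ∈ disc
      · have := spaceZ_norm_apply_le hf hz
        rw [h] at this
        exact norm_le_zero_iff.1 this
      · exact hf.2.1 z hz
    · rintro rfl
      refine (spaceZ_norm_le hf le_rfl fun z hz => ?_).antisymm (spaceZ_norm_nonneg _)
      rw [bdryExt_zero (Metric.sphere_subset_closedBall hz), lpNorm]
      exact (eLpNorm_zero (ε := ℂ) (p := ω.p z) (μ := (Measure.count : Measure ℕ))).le.trans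
        zero_le
  norm_add_le f hf g hg := by
    refine spaceZ_norm_le ((spaceZ ω).carrier.add_mem hf hg)
      (add_nonneg (spaceZ_norm_nonneg _) (spaceZ_norm_nonneg _)) fun z hz => ?_
    have hz' := Metric.sphere_subset_closedBall hz
    rw [bdryExt_add hf.1 hf.2.2.1 hg.1 hg.2.2.1 hz',
      ENNReal.ofReal_add (spaceZ_norm_nonneg _) (spaceZ_norm_nonneg _)]
    exact (lpNorm_add_le (ω.one_le_p hz') _ _).trans
      (add_le_add (spaceZ_lpNorm_le hf hz') (spaceZ_lpNorm_le hg hz'))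
  norm_smul c f hf := by
    have h : ∀ (c : ℂ) (f : ℂ → LInf), f ∈ (spaceZ ω).carrier →
        (spaceZ ω).norm (c • f) ≤ ‖c‖ * (spaceZ ω).norm f := fun c f hf =>
      (spaceZ_mul_mem hf (φ := fun _ => c) (ψ := fun _ => c) (norm_nonneg c) continuousOn_const
        (differentiableOn_const c) (fun _ _ => rfl) fun _ _ => le_rfl).2
    refine (h c f hf).antisymm ?_
    by_cases hc : c = 0
    · simp [hc, spaceZ_norm_nonneg]
    · have h2 := h c⁻¹ (c • f) ((spaceZ ω).carrier.smul_mem c hf)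
      rw [smul_smul, inv_mul_cancel₀ hc, one_smul, norm_inv] at h2
      have h3 : 0 < ‖c‖ := norm_pos_iff.2 hc
      rwa [le_inv_mul_iff₀ h3] at h2
  complete u hu h := spaceZ_complete ω u hu h
  eval_bounded z hz := ⟨1, fun f hf => by simpa using spaceZ_norm_apply_le hf hz⟩
  mul_mem_iff φ hφ f hf hf0 := by
    obtain ⟨ψ, hψ, heq, hψ1⟩ := hφ.exists_extension
    refine ⟨fun h => (spaceZ_mul_mem h zero_le_one hψ hφ.1 heq fun z hz => (hψ1 z hz).le).1,
      fun h => (spaceZ_mem_of_mul_mem hf.differentiableOn hf0 zero_le_one hψ heq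
        (fun z hz h0 => ?_) (fun z hz => ?_) h).1⟩
    · simpa [h0] using hψ1 z hz
    · simp [hψ1 z hz]
  norm_mul φ hφ f hf := by
    obtain ⟨ψ, hψ, heq, hψ1⟩ := hφ.exists_extension
    have h := spaceZ_mul_mem hf zero_le_one hψ hφ.1 heq fun z hz => (hψ1 z hz).le
    rw [one_mul] at h
    refine h.2.antisymm ?_
    have h2 := (spaceZ_mem_of_mul_mem (C := 1) (spaceZ_differentiableOn hf) hf.2.1 zero_le_one hψ
      heq (fun z hz h0 => by simpa [h0] using hψ1 z hz) (fun z hz => by simp [hψ1 z hz]) h.1).2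
    rwa [one_mul] at h2

end Admissible

/-- Choose on one representative of each line of V and extend by scaling; the scalar is unique
because the representative is nonzero. -/
theorem exists_homogeneous_choice {V W : Type*} [AddCommGroup V] [Module ℂ V] [AddCommGroup W]
    [Module ℂ W] (P : V → W → Prop) (h : ∀ x, x ≠ 0 → ∃ w, P x w) (h0 : P 0 0)
    (hs : ∀ (c : ℂ) x w, c ≠ 0 → P x w → P (c • x) (c • w)) :
    ∃ s : V → W, (∀ x, P x (s x)) ∧ ∀ (c : ℂ) x, s (c • x) = c • s x := by
  classical
  choose w hw using h
  have hex : ∀ (x : V) (hx : x ≠ 0), ∃ a : ℂ, a ≠ 0 ∧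
      a • (Projectivization.mk ℂ x hx).rep = x := by
    intro x hx
    obtain ⟨a, ha⟩ := Projectivization.exists_smul_eq_mk_rep ℂ x hx
    refine ⟨((a⁻¹ : ℂˣ) : ℂ), (a⁻¹).ne_zero, ?_⟩
    rw [← ha]
    exact inv_smul_smul a x
  choose a ha0 hax using hex
  have hw' : ∀ p : Projectivization ℂ V, P p.rep (w p.rep p.rep_nonzero) := fun p => hw _ _
  refine ⟨fun x => if hx : x = 0 then 0 else
    a x hx • w (Projectivization.mk ℂ x hx).rep (Projectivization.rep_nonzero _), fun x => ?_,
    fun c x => ?_⟩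
  · by_cases hx : x = 0
    · simpa [hx] using h0
    · simp only [hx, dif_neg, not_false_eq_true]
      have h1 := hs (a x hx) _ _ (ha0 x hx) (hw' (Projectivization.mk ℂ x hx))
      rwa [hax] at h1
  · by_cases hx : x = 0
    · simp [hx]
    by_cases hc : c = 0
    · simp [hc]
    have hcx : c • x ≠ 0 := smul_ne_zero hc hx
    have hmk : Projectivization.mk ℂ (c • x) hcx = Projectivization.mk ℂ x hx := by
      rw [Projectivization.mk_eq_mk_iff']
      exact ⟨c, rfl⟩
    have h1 : a (c • x) hcx = c * a x hx := by
      refine smul_left_injective ℂ (Projectivization.rep_nonzero (Projectivization.mk ℂ x hx)) ?_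
      simp only
      rw [mul_smul, hax, ← hmk, hax]
    simp only [hx, hcx, dif_neg, not_false_eq_true, h1, mul_smul, hmk]

/-! ### Division by z - ζ, quotient norms and selections -/

section SpaceZ

variable {ω : Config}

theorem spaceZ_taylorCoeff_le (ω : Config) (ζ : disc) (i : ℕ) :
    ∃ C : ℝ, 0 ≤ C ∧ ∀ f ∈ (spaceZ ω).carrier,
      ‖taylorCoeff f ζ i‖ ≤ C * (spaceZ ω).norm f := by
  obtain ⟨C, hC, h⟩ := norm_taylorCoeff_le (E := LInf) ζ.2 i
  exact ⟨C, hC, fun f hf => h f _ (spaceZ_differentiableOn hf) fun z hz =>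
    spaceZ_norm_apply_le hf hz⟩

theorem one_sub_norm_pos (ζ : disc) : 0 < 1 - ‖(ζ : ℂ)‖ := by
  have : ‖(ζ : ℂ)‖ < 1 := mem_ball_zero_iff.1 ζ.2
  linarith

/-- The norm is controlled on the circle, where |z - ζ| ≥ 1 - |ζ|. -/
theorem spaceZ_exists_div (ζ : disc) {f : ℂ → LInf} (hf : f ∈ (spaceZ ω).carrier)
    (h0 : f ζ = 0) : ∃ g ∈ (spaceZ ω).carrier, (∀ z, f z = (z - ζ) • g z) ∧
      (spaceZ ω).norm g ≤ (1 - ‖(ζ : ℂ)‖)⁻¹ * (spaceZ ω).norm f := by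
  classical
  set g : ℂ → LInf := fun z => if z ∈ disc then dslope f ζ z else 0 with hg
  have hgd : DifferentiableOn ℂ g disc :=
    ((Complex.differentiableOn_dslope (Metric.isOpen_ball.mem_nhds ζ.2)).2
      (spaceZ_differentiableOn hf)).congr fun z hz => by simp only [hg, if_pos hz]
  have hfg : ∀ z, f z = (z - ζ) • g z := by
    intro z
    by_cases hz : z ∈ disc
    · simp only [hg, if_pos hz, sub_smul_dslope, h0, sub_zero]
    · simp only [hg, if_neg hz, smul_zero, hf.2.1 z hz]
  have hpos := one_sub_norm_pos ζ
  have hlow : ∀ z ∈ Metric.sphere (0 : ℂ) 1, 1 - ‖(ζ : ℂ)‖ ≤ ‖z - ζ‖ := by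
    intro z hz
    have h1 : ‖z‖ = 1 := by simpa using hz
    rw [← h1]
    exact norm_sub_norm_le z ζ
  have h := spaceZ_mem_of_mul_mem (ω := ω) (f := g) (φ := fun z => z - ζ) (ψ := fun z => z - ζ)
    hgd (fun z hz => by simp only [hg, if_neg hz]) (inv_nonneg.2 hpos.le) (by fun_prop)
    (fun _ _ => rfl) (fun z hz => norm_pos_iff.1 (hpos.trans_le (hlow z hz)))
    (fun z hz => by rw [norm_inv]; exact inv_anti₀ hpos (hlow z hz))
    (by rwa [← funext hfg])
  rw [← funext hfg] at h
  exact ⟨g, h.1, hfg, h.2⟩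

theorem spaceZ_exists_pow_div (ζ : disc) (n : ℕ) {f : ℂ → LInf} (hf : f ∈ (spaceZ ω).carrier)
    (h0 : ∀ i < n, taylorCoeff f ζ i = 0) : ∃ g ∈ (spaceZ ω).carrier,
      (∀ i, taylorCoeff g ζ i = taylorCoeff f ζ (n + i)) ∧
      (spaceZ ω).norm g ≤ (1 - ‖(ζ : ℂ)‖)⁻¹ ^ n * (spaceZ ω).norm f := by
  induction n generalizing f with
  | zero => exact ⟨f, hf, by simp, by simp⟩
  | succ n ih =>
    obtain ⟨g, hg, hfg, hgn⟩ := spaceZ_exists_div ζ hf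
      (by rw [← taylorCoeff_zero f]; exact h0 0 n.succ_pos)
    have hc : ∀ i, taylorCoeff f ζ (i + 1) = taylorCoeff g ζ i := fun i => by
      rw [funext hfg]
      exact taylorCoeff_sub_smul_succ (hg.1 ζ ζ.2) i
    obtain ⟨k, hk, hkc, hkn⟩ := ih hg fun i hi => by
      rw [← hc]; exact h0 (i + 1) (by omega)
    refine ⟨k, hk, fun i => ?_, hkn.trans ?_⟩
    · rw [hkc, ← hc]; congr 1; omega
    · have := one_sub_norm_pos ζ
      calc _ ≤ (1 - ‖(ζ : ℂ)‖)⁻¹ ^ n * ((1 - ‖(ζ : ℂ)‖)⁻¹ * (spaceZ ω).norm f) := by gcongr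
        _ = _ := by ring

theorem spaceZ_quotNorm_nonneg (ζ : disc) (n : ℕ) (x : Fin n → LInf) :
    0 ≤ (spaceZ ω).quotNorm ζ n x := by
  refine Real.sInf_nonneg ?_
  rintro _ ⟨f, _, rfl⟩
  exact spaceZ_norm_nonneg _

theorem spaceZ_quotNorm_le (ζ : disc) (n : ℕ) {x : Fin n → LInf} (f : (spaceZ ω).carrier)
    (hf : (spaceZ ω).jet ζ n f = x) : (spaceZ ω).quotNorm ζ n x ≤ (spaceZ ω).norm f := by
  refine csInf_le ⟨0, ?_⟩ ⟨f, hf, rfl⟩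
  rintro _ ⟨f, _, rfl⟩
  exact spaceZ_norm_nonneg _

theorem spaceZ_le_quotNorm (ζ : disc) (n : ℕ) {x : Fin n → LInf} (hx : x ∈ (spaceZ ω).space ζ n)
    {r : ℝ} (h : ∀ f : (spaceZ ω).carrier, (spaceZ ω).jet ζ n f = x → r ≤ (spaceZ ω).norm f) :
    r ≤ (spaceZ ω).quotNorm ζ n x := by
  obtain ⟨f, hf⟩ := hx
  refine le_csInf ⟨_, f, hf, rfl⟩ ?_
  rintro _ ⟨f, hf, rfl⟩
  exact h f hf

theorem spaceZ_exists_lt_of_quotNorm_lt (ζ : disc) (n : ℕ) {x : Fin n → LInf}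
    (hx : x ∈ (spaceZ ω).space ζ n) {r : ℝ} (h : (spaceZ ω).quotNorm ζ n x < r) :
    ∃ f : (spaceZ ω).carrier, (spaceZ ω).jet ζ n f = x ∧ (spaceZ ω).norm f < r := by
  obtain ⟨f, hf⟩ := hx
  have hne : {r : ℝ | ∃ f : (spaceZ ω).carrier, (spaceZ ω).jet ζ n f = x ∧
      (spaceZ ω).norm (f : ℂ → LInf) = r}.Nonempty := ⟨_, f, hf, rfl⟩
  obtain ⟨_, ⟨g, hg, rfl⟩, hr⟩ := exists_lt_of_csInf_lt hne h
  exact ⟨g, hg, hr⟩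

/-- Cauchy's estimate bounds every entry of a jet by the norm of the function. Positivity leaves
room between ‖x‖ and C‖x‖ when C > 1, so that selections exist although the infimum need not be
attained. -/
theorem spaceZ_quotNorm_pos (ζ : disc) (n : ℕ) {x : Fin n → LInf}
    (hx : x ∈ (spaceZ ω).space ζ n) (h0 : x ≠ 0) : 0 < (spaceZ ω).quotNorm ζ n x := by
  obtain ⟨i, hi⟩ := Function.ne_iff.1 h0
  obtain ⟨C, hC, h⟩ := spaceZ_taylorCoeff_le ω ζ i
  have hxi : 0 < ‖x i‖ := norm_pos_iff.2 hi
  refine lt_of_lt_of_le (div_pos hxi (by linarith : 0 < C + 1))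
    (spaceZ_le_quotNorm ζ n hx fun f hf => ?_)
  rw [div_le_iff₀ (by linarith)]
  have h1 := h f f.2
  have h2 : taylorCoeff (f : ℂ → LInf) ζ i = x i := congrFun hf i
  rw [h2] at h1
  nlinarith [spaceZ_norm_nonneg (ω := ω) f]

theorem spaceZ_norm_smul (c : ℂ) {f : ℂ → LInf} (hf : f ∈ (spaceZ ω).carrier) :
    (spaceZ ω).norm (c • f) = ‖c‖ * (spaceZ ω).norm f :=
  (spaceZ_isAdmissible ω).norm_smul c f hf

theorem spaceZ_smul_quotNorm_le (ζ : disc) (n : ℕ) {x : Fin n → LInf}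
    (hx : x ∈ (spaceZ ω).space ζ n) {c : ℂ} (hc : c ≠ 0) :
    ‖c‖ * (spaceZ ω).quotNorm ζ n x ≤ (spaceZ ω).quotNorm ζ n (c • x) := by
  refine spaceZ_le_quotNorm ζ n (((spaceZ ω).space ζ n).smul_mem c hx) fun f hf => ?_
  have h1 := spaceZ_quotNorm_le ζ n (x := x) (c⁻¹ • f) (by
    rw [map_smul, hf, smul_smul, inv_mul_cancel₀ hc, one_smul])
  rw [Submodule.coe_smul, spaceZ_norm_smul _ f.2, norm_inv] at h1
  rwa [← le_inv_mul_iff₀ (norm_pos_iff.2 hc)]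

/-- Homogeneous selections exist as soon as the values can be found pointwise. -/
theorem spaceZ_exists_isSelection (ζ : disc) (n : ℕ) {C : ℝ} (hC : 0 ≤ C)
    (Q : (spaceZ ω).carrier → Prop)
    (hQ0 : Q 0) (hQ : ∀ (c : ℂ) f, Q f → Q (c • f))
    (h : ∀ x ∈ (spaceZ ω).space ζ n, x ≠ 0 → ∃ f : (spaceZ ω).carrier,
      (spaceZ ω).jet ζ n f = x ∧ Q f ∧ (spaceZ ω).norm f ≤ C * (spaceZ ω).quotNorm ζ n x) :
    ∃ s, (spaceZ ω).IsSelection ζ n C s ∧ ∀ x, Q (s x) := by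
  have hch := exists_homogeneous_choice
    (V := (spaceZ ω).space ζ n) (W := (spaceZ ω).carrier)
    (fun x f => (spaceZ ω).jet ζ n f = x ∧ Q f ∧
      (spaceZ ω).norm f ≤ C * (spaceZ ω).quotNorm ζ n x)
    (fun x hx => h x x.2 fun h0 => hx (Subtype.ext h0))
    ⟨map_zero _, hQ0, by
      have h1 : (spaceZ ω).norm ((0 : (spaceZ ω).carrier) : ℂ → LInf) = 0 :=
        ((spaceZ_isAdmissible ω).norm_eq_zero 0 (zero_mem _)).2 rfl
      rw [h1]
      exact mul_nonneg hC (spaceZ_quotNorm_nonneg _ _ _)⟩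
    (fun c x f hc ⟨h1, h2, h3⟩ => ⟨by rw [map_smul, h1]; rfl, hQ c f h2, by
      rw [Submodule.coe_smul, spaceZ_norm_smul _ f.2]
      calc ‖c‖ * (spaceZ ω).norm f ≤ ‖c‖ * (C * (spaceZ ω).quotNorm ζ n x) := by gcongr
        _ = C * (‖c‖ * (spaceZ ω).quotNorm ζ n x) := by ring
        _ ≤ _ := by
          gcongr
          exact spaceZ_smul_quotNorm_le ζ n x.2 hc⟩)
  obtain ⟨s, hs, hsm⟩ := hch
  exact ⟨s, ⟨fun x => (hs x).1, fun x => (hs x).2.2, hsm⟩, fun x => (hs x).2.1⟩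

theorem spaceZ_exists_isSelection_of_one_lt (ζ : disc) (n : ℕ) {C : ℝ} (hC : 1 < C) :
    ∃ s, (spaceZ ω).IsSelection ζ n C s := by
  obtain ⟨s, hs, -⟩ := spaceZ_exists_isSelection (ω := ω) ζ n (zero_le_one.trans hC.le)
    (fun _ => True) trivial
    (fun _ _ _ => trivial) fun x hx hx0 => by
      have h1 := spaceZ_quotNorm_pos ζ n hx hx0
      obtain ⟨f, hf, hfn⟩ := spaceZ_exists_lt_of_quotNorm_lt ζ n hx
        (r := C * (spaceZ ω).quotNorm ζ n x) (by nlinarith)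
      exact ⟨f, hf, trivial, hfn.le⟩
  exact ⟨s, hs⟩

end SpaceZ

/-! ### Null sequences of weights with small loss of norm -/

section Weights

/-- The weighted arithmetic-geometric mean inequality for T and c + T, divided by (c + T)^s. With T
and c + T consecutive tails of a series, the right-hand side telescopes. -/
theorem mul_rpow_neg_le_sub {c T s : ℝ} (hc : 0 ≤ c) (hT : 0 ≤ T) (hs : 0 < s) (hs1 : s < 1) :
    (1 - s) * (c / (c + T) ^ s) ≤ (c + T) ^ (1 - s) - T ^ (1 - s) := by
  have h1 : (0 : ℝ) < 1 - s := sub_pos.2 hs1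
  rcases (add_nonneg hc hT).eq_or_lt with h0 | h0
  · have hc0 : c = 0 := by linarith
    have hT0 : T = 0 := by linarith
    simp [hc0, hT0]
  · have h2 := Real.geom_mean_le_arith_mean2_weighted h1.le hs.le hT h0.le (by ring)
    have h3 : 0 < (c + T) ^ s := by positivity
    have h4 : (c + T) ^ (1 - s) = (c + T) / (c + T) ^ s := by
      rw [Real.rpow_sub h0, Real.rpow_one]
    rw [h4, le_sub_iff_add_le, ← mul_div_assoc, ← le_sub_iff_add_le', ← sub_div, le_div_iff₀ h3]
    linarith

/-- A convergent series of nonnegative terms still converges after division by suitable powers of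
its tails. -/
theorem exists_tail_weights {c : ℕ → ℝ} (hc : ∀ i, 0 ≤ c i)
    (hsum : ∀ S : Finset ℕ, ∑ i ∈ S, c i ≤ 1) {s : ℝ} (hs : 0 < s) (hs1 : s < 1) :
    ∃ t : ℕ → ℝ, (∀ i, 0 ≤ t i) ∧ (∀ i, t i ≤ 1) ∧ (∀ i, c i ≤ t i) ∧ Tendsto t atTop (𝓝 0) ∧
      ∀ S : Finset ℕ, (1 - s) * ∑ i ∈ S, c i / t i ^ s ≤ 1 := by
  have hsm : Summable c := summable_of_sum_le hc hsum
  -- The tails of the series: consecutive ones differ by c_i.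
  set t : ℕ → ℝ := fun i => ∑' l, c (l + i) with ht
  have ht0 : ∀ i, 0 ≤ t i := fun i => tsum_nonneg fun l => hc _
  have hsucc : ∀ i, t i = c i + t (i + 1) := by
    intro i
    have h := ((summable_nat_add_iff i).2 hsm).tsum_eq_zero_add
    simp only [ht, h, zero_add]
    congr 2
    funext l
    congr 1
    omega
  have hanti : ∀ i, t i ≤ t 0 := by
    intro i
    induction i with
    | zero => exact le_rfl
    | succ i ih => linarith [hsucc i, hc i]
  have ht1 : t 0 ≤ 1 := by
    simp only [ht, add_zero]
    exact hsm.tsum_le_of_sum_le hsum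
  refine ⟨t, ht0, fun i => (hanti i).trans ht1, fun i => ?_, tendsto_sum_nat_add c, fun S => ?_⟩
  · linarith [hsucc i, ht0 (i + 1)]
  · have h1 : (0 : ℝ) < 1 - s := sub_pos.2 hs1
    have hrange : ∀ n, (1 - s) * ∑ i ∈ Finset.range n, c i / t i ^ s ≤
        t 0 ^ (1 - s) - t n ^ (1 - s) := by
      intro n
      induction n with
      | zero => simp
      | succ n ih =>
        have h := mul_rpow_neg_le_sub (hc n) (ht0 (n + 1)) hs hs1
        rw [← hsucc n] at h
        rw [Finset.sum_range_succ, mul_add]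
        linarith
    obtain ⟨n, hn⟩ := S.exists_nat_subset_range
    calc (1 - s) * ∑ i ∈ S, c i / t i ^ s ≤ (1 - s) * ∑ i ∈ Finset.range n, c i / t i ^ s := by
          refine mul_le_mul_of_nonneg_left ?_ h1.le
          exact Finset.sum_le_sum_of_subset_of_nonneg hn fun i _ _ =>
            div_nonneg (hc i) (Real.rpow_nonneg (ht0 i) _)
      _ ≤ t 0 ^ (1 - s) - t n ^ (1 - s) := hrange n
      _ ≤ 1 - 0 := by
        gcongr
        · exact Real.rpow_le_one (ht0 0) ht1 h1.le
        · exact Real.rpow_nonneg (ht0 n) _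
      _ = 1 := sub_zero 1

/-- With the constant weight r the extremal function need not be continuous into ℓ_∞: where Re ω = 0
all its nonzero coordinates have modulus r. Null weights ρ cure this at the price of the factor K.
-/
theorem exists_weights {θ r K : ℝ} (hθ : 0 < θ) (hθ1 : θ ≤ 1) (hr : 0 < r) (hK : 1 < K) {x : LInf}
    (hx : lpNorm (ENNReal.ofReal θ)⁻¹ x ≤ ENNReal.ofReal r) :
    ∃ ρ : ℕ → ℝ, (∀ i, 0 ≤ ρ i) ∧ (∀ i, ρ i ≤ K * r) ∧ (∀ i, x i ≠ 0 → 0 < ρ i) ∧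
      Tendsto ρ atTop (𝓝 0) ∧ ∀ S : Finset ℕ, ∑ i ∈ S, (‖x i‖ / ρ i) ^ θ⁻¹ ≤ 1 := by
  have hK0 : 0 < K := zero_lt_one.trans hK
  have hi : 0 < θ⁻¹ := inv_pos.2 hθ
  -- With this s, the factor 1/K that ρ_i = r (K t_i^s)^θ produces is the constant 1 - s of the tail
  -- estimate.
  set s : ℝ := 1 - K⁻¹ with hs
  have hs0 : 0 < s := sub_pos.2 (inv_lt_one_of_one_lt₀ hK)
  have hs1 : s < 1 := sub_lt_self _ (inv_pos.2 hK0)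
  obtain ⟨t, ht0, ht1, hct, htl, hsum⟩ := exists_tail_weights (c := fun i => (‖x i‖ / r) ^ θ⁻¹)
    (fun i => by positivity) (fun S => by
      have h := (lpNorm_le_iff_sum_rpow hθ hr.le x).1 hx S
      have h2 : ∀ i ∈ S, (‖x i‖ / r) ^ θ⁻¹ = ‖x i‖ ^ θ⁻¹ / r ^ θ⁻¹ := fun i _ =>
        Real.div_rpow (norm_nonneg _) hr.le _
      rw [Finset.sum_congr rfl h2, ← Finset.sum_div]
      exact div_le_one_of_le₀ h (by positivity)) hs0 hs1
  have hts : ∀ i, 0 ≤ t i ^ s := fun i => Real.rpow_nonneg (ht0 i) _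
  refine ⟨fun i => r * (K * t i ^ s) ^ θ, fun i => ?_, fun i => ?_, fun i hxi => ?_, ?_,
    fun S => ?_⟩
  · have := hts i
    positivity
  · rw [mul_comm K]
    refine mul_le_mul_of_nonneg_left ?_ hr.le
    calc (K * t i ^ s) ^ θ ≤ K ^ θ := by
          have h1 : K * t i ^ s ≤ K * 1 := by
            gcongr
            exact Real.rpow_le_one (ht0 i) (ht1 i) hs0.le
          rw [mul_one] at h1
          exact Real.rpow_le_rpow (mul_nonneg hK0.le (hts i)) h1 hθ.le
      _ ≤ K ^ (1 : ℝ) := Real.rpow_le_rpow_of_exponent_le hK.le hθ1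
      _ = K := Real.rpow_one K
  · have h1 : 0 < ‖x i‖ := norm_pos_iff.2 hxi
    have h2 : 0 < t i := lt_of_lt_of_le (by positivity) (hct i)
    positivity
  · have h1 : Tendsto (fun i => t i ^ s) atTop (𝓝 0) := by
      have := htl.rpow_const (p := s) (Or.inr hs0.le)
      rwa [Real.zero_rpow hs0.ne'] at this
    have h2 := ((h1.const_mul K).rpow_const (p := θ) (Or.inr hθ.le)).const_mul r
    rwa [mul_zero, Real.zero_rpow hθ.ne', mul_zero] at h2
  · have h1 : ∀ i ∈ S, (‖x i‖ / (r * (K * t i ^ s) ^ θ)) ^ θ⁻¹ =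
        (1 - s) * ((‖x i‖ / r) ^ θ⁻¹ / t i ^ s) := by
      intro i _
      have h2 : 0 ≤ K * t i ^ s := mul_nonneg hK0.le (hts i)
      rw [← div_div, Real.div_rpow (by positivity) (by positivity),
        Real.rpow_rpow_inv h2 hθ.ne', ← div_div, hs]
      ring
    rw [Finset.sum_congr rfl h1, ← Finset.mul_sum]
    exact hsum S

end Weights

/-! ### Almost optimal functions through a given vector -/

section Extremal

/-- A family of scalar functions dominated by a null sequence is a function into `ℓ_∞`, continuous
and analytic where its coordinates are. -/
theorem exists_lInf_valued {G : ℕ → ℂ → ℂ} {ρ : ℕ → ℝ} (hρ : Tendsto ρ atTop (𝓝 0))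
    (hG : ∀ i, ∀ z ∈ Metric.closedBall (0 : ℂ) 1, ‖G i z‖ ≤ ρ i)
    (hc : ∀ i, ContinuousOn (G i) (Metric.closedBall 0 1))
    (hd : ∀ i, DifferentiableOn ℂ (G i) disc) :
    ∃ F : ℂ → LInf, ContinuousOn F (Metric.closedBall 0 1) ∧ DifferentiableOn ℂ F disc ∧
      ∀ z ∈ Metric.closedBall (0 : ℂ) 1, ∀ i, F z i = G i z := by
  classical
  obtain ⟨B, hB⟩ := hρ.bddAbove_range
  have hmem : ∀ z ∈ Metric.closedBall (0 : ℂ) 1, Memℓp (E := fun _ : ℕ => ℂ) (fun i => G i z) ∞ := by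
    intro z hz
    refine memℓp_infty ⟨B, ?_⟩
    rintro _ ⟨i, rfl⟩
    exact (hG i z hz).trans (hB ⟨i, rfl⟩)
  set F : ℂ → LInf := fun z => if hz : z ∈ Metric.closedBall (0 : ℂ) 1 then
    ⟨fun i => G i z, hmem z hz⟩ else 0 with hF
  have hFi : ∀ z ∈ Metric.closedBall (0 : ℂ) 1, ∀ i, F z i = G i z := by
    intro z hz i
    simp only [hF, dif_pos hz]
  -- Coordinate truncations; they converge uniformly since the omitted coordinates are dominated by
  -- the tail of the null sequence ρ.
  set T : ℕ → ℂ → LInf := fun n z => ∑ i ∈ Finset.range n, G i z • lp.single ∞ i (1 : ℂ) with hT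
  have hTi : ∀ n z i, T n z i = if i < n then G i z else 0 := by
    intro n z i
    simp only [hT]
    rw [← coord_apply, map_sum]
    simp only [map_smul, coord_apply, lp.single_apply, smul_eq_mul, Pi.single_apply]
    simp
  have hu : TendstoUniformlyOn T F atTop (Metric.closedBall 0 1) := by
    rw [Metric.tendstoUniformlyOn_iff]
    intro ε hε
    obtain ⟨n, hn⟩ := Metric.tendsto_atTop.1 hρ (ε / 2) (half_pos hε)
    filter_upwards [eventually_ge_atTop n] with m hm z hz
    rw [dist_eq_norm]
    refine lt_of_le_of_lt (lp.norm_le_of_forall_le (half_pos hε).le fun i => ?_) (half_lt_self hε)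
    rw [lp.coeFn_sub, Pi.sub_apply, hFi z hz, hTi]
    by_cases him : i < m
    · simp [him, (half_pos hε).le]
    · have h1 := hn i (by omega)
      rw [Real.dist_0_eq_abs] at h1
      simp only [him, if_false, sub_zero]
      exact (hG i z hz).trans ((le_abs_self _).trans h1.le)
  refine ⟨F, hu.continuousOn (Frequently.of_forall fun n => ?_), ?_, hFi⟩
  · exact continuousOn_finsetSum _ fun i _ => (hc i).smul continuousOn_const
  · refine (hu.mono disc_subset_closedBall).tendstoLocallyUniformlyOn.differentiableOn
      (Eventually.of_forall fun n => ?_) Metric.isOpen_ball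
    exact DifferentiableOn.fun_sum fun i _ => (hd i).smul_const _

/-- Write exp w = 1 + w E(w) with E entire and E(0) = 1. The order N makes low Taylor coefficients
vanish, and the value l h(c) of r is the source of the term log|S| h(ζ). -/
theorem exists_exp_eq_one_add_pow_mul {g h : ℂ → ℂ} {c : ℂ} {N : ℕ} (hN : 1 ≤ N)
    (hh : AnalyticAt ℂ h c) (hg : g =ᶠ[𝓝 c] fun z => (z - c) ^ N * h z) (l : ℂ) :
    ∃ r : ℂ → ℂ, AnalyticAt ℂ r c ∧ r c = l * h c ∧
      (fun z => Complex.exp (l * g z)) =ᶠ[𝓝 c] fun z => 1 + (z - c) ^ N * r z := by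
  set E : ℂ → ℂ := dslope Complex.exp 0 with hE
  have hEd : Differentiable ℂ E := by
    have := (Complex.differentiableOn_dslope (f := Complex.exp) (c := 0) (s := univ) univ_mem).2
      Complex.differentiable_exp.differentiableOn
    exact differentiableOn_univ.1 this
  have hE0 : E 0 = 1 := by simp [hE, dslope_same]
  have hEe : ∀ w, Complex.exp w = 1 + w * E w := by
    intro w
    have := sub_smul_dslope Complex.exp 0 w
    rw [Complex.exp_zero, sub_zero, smul_eq_mul] at this
    rw [hE, this]
    ring
  refine ⟨fun z => l * h z * E (l * ((z - c) ^ N * h z)), ?_, ?_, ?_⟩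
  · refine (analyticAt_const.mul hh).mul (AnalyticAt.fun_comp (hEd.analyticAt _) ?_)
    fun_prop
  · simp [hE0, zero_pow (by omega : N ≠ 0)]
  · filter_upwards [hg] with z hz
    rw [hEe, hz]
    ring

/-- Almost optimal functions with a given value at `ζ` whose Taylor coefficients at `ζ` vanish up
to the order to which `ω` is constant there. -/
theorem spaceZ_exists_extremal (ω : Config) (ζ : disc) {N : ℕ} (hN : 1 ≤ N) {h : ℂ → ℂ}
    (hh : AnalyticAt ℂ h ζ)
    (hω : (fun z => ω.toFun z - ω.toFun ζ) =ᶠ[𝓝 (ζ : ℂ)] fun z => (z - ζ) ^ N * h z)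
    {x : LInf} {r : ℝ} (hr : 0 ≤ r) (hx : lpNorm (ω.p ζ) x ≤ ENNReal.ofReal r)
    {K : ℝ} (hK : 1 < K) :
    ∃ f ∈ (spaceZ ω).carrier, f ζ = x ∧ (∀ a, 0 < a → a < N → taylorCoeff f ζ a = 0) ∧
      (spaceZ ω).norm f ≤ K * r := by
  classical
  set θ := (ω.toFun ζ).re with hθdef
  have hθ : 0 < θ := (ω.mapsTo ζ.2).1
  have hθ1 : θ < 1 := (ω.mapsTo ζ.2).2
  have hζ := disc_subset_closedBall ζ.2
  rcases hr.eq_or_lt with rfl | hr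
  · refine ⟨0, zero_mem _, ?_, fun a _ _ => ?_, ?_⟩
    · have := norm_le_of_lpNorm_le hθ.le hθ1.le le_rfl hx
      rw [norm_le_zero_iff.1 this]
      rfl
    · simpa using taylorCoeff_smul (f := (0 : ℂ → LInf)) (z := (ζ : ℂ)) analyticAt_const 0 a
    · rw [((spaceZ_isAdmissible ω).norm_eq_zero 0 (zero_mem _)).2 rfl, mul_zero]
  obtain ⟨ρ, hρ0, hρK, hρx, hρl, hsum⟩ := exists_weights hθ hθ1.le hr hK hx
  have hK0 : 0 < K := zero_lt_one.trans hK
  -- The coordinates below are x_i (|x_i|/ρ_i)^((ω(z)-ω(ζ))/θ). Their moduli are at most ρ_i a_i^(Re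
  -- ω(z)) with ∑ a_i ≤ 1, hence Hölder's inequality bounds the norm at every z. Where x_i = 0 the
  -- value of l_i is irrelevant.
  set l : ℕ → ℝ := fun i => Real.log (‖x i‖ / ρ i) / θ with hl
  set G : ℕ → ℂ → ℂ := fun i z => x i * Complex.exp (l i * (ω.toFun z - ω.toFun ζ)) with hG
  set a : ℕ → ℝ := fun i => (‖x i‖ / ρ i) ^ θ⁻¹ with ha
  have ha0 : ∀ i, 0 ≤ a i := fun i => Real.rpow_nonneg (div_nonneg (norm_nonneg _) (hρ0 i)) _
  have ha1 : ∀ i, a i ≤ 1 := fun i => by simpa using hsum {i}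
  have hGa : ∀ i z, ‖G i z‖ ≤ ρ i * a i ^ (ω.toFun z).re := by
    intro i z
    by_cases hxi : x i = 0
    · simp only [hG, hxi, zero_mul, norm_zero]
      exact mul_nonneg (hρ0 i) (Real.rpow_nonneg (ha0 i) _)
    · have h1 := hρx i hxi
      have h2 : 0 < ‖x i‖ := norm_pos_iff.2 hxi
      have h3 : 0 < ‖x i‖ / ρ i := div_pos h2 h1
      have h4 : ((l i : ℂ) * (ω.toFun z - ω.toFun ζ)).re =
          Real.log (‖x i‖ / ρ i) * (θ⁻¹ * (ω.toFun z).re) + -Real.log (‖x i‖ / ρ i) := by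
        rw [Complex.re_ofReal_mul, Complex.sub_re, hl]
        simp only [← hθdef]
        field_simp
        ring
      simp only [hG, norm_mul, Complex.norm_exp]
      rw [h4, Real.exp_add, ← Real.rpow_def_of_pos h3, Real.exp_neg, Real.exp_log h3, ha,
        ← Real.rpow_mul h3.le]
      refine le_of_eq ?_
      field_simp
  obtain ⟨F, hFc, hFd, hFi⟩ := exists_lInf_valued (G := G) hρl
    (fun i z hz => (hGa i z).trans (by
      have := Real.rpow_le_one (ha0 i) (ha1 i) (ω.re_mem_Icc hz).1
      nlinarith [hρ0 i]))
    (fun i => continuousOn_const.mul (Complex.continuous_exp.comp_continuousOn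
      (continuousOn_const.mul (ω.continuousOn.sub continuousOn_const))))
    (fun i => DifferentiableOn.const_mul (DifferentiableOn.cexp
      ((ω.differentiableOn.sub (differentiableOn_const _)).const_mul _)) _)
  set f : ℂ → LInf := fun z => if z ∈ disc then F z else 0 with hf
  have hfF : EqOn f F disc := fun z hz => by simp only [hf, if_pos hz]
  have hmem := spaceZ_mem (ω := ω) (f := f) (F := F) (R := K * r) (by positivity) hFc hFd hfF
    (fun z hz => by simp only [hf, if_neg hz]) (fun z hz => by
      have hz' := Metric.sphere_subset_closedBall hz
      rw [ω.lpNorm_le_iff hz' (by positivity)]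
      intro S b hb hs
      calc ∑ i ∈ S, ‖F z i‖ * b i ^ (1 - (ω.toFun z).re)
          ≤ ∑ i ∈ S, (K * r) * (a i ^ (ω.toFun z).re * b i ^ (1 - (ω.toFun z).re)) := by
            refine Finset.sum_le_sum fun i _ => ?_
            rw [hFi z hz' i, ← mul_assoc]
            refine mul_le_mul_of_nonneg_right ((hGa i z).trans ?_) (Real.rpow_nonneg (hb i) _)
            exact mul_le_mul_of_nonneg_right (hρK i) (Real.rpow_nonneg (ha0 i) _)
        _ = K * r * ∑ i ∈ S, a i ^ (ω.toFun z).re * b i ^ (1 - (ω.toFun z).re) := by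
            rw [Finset.mul_sum]
        _ ≤ K * r * 1 := by
            gcongr
            exact sum_rpow_mul_rpow_le_one (ω.re_mem_Icc hz').1 (ω.re_mem_Icc hz').2 ha0 hb
              (hsum S) hs
        _ = K * r := mul_one _)
  refine ⟨f, hmem.1, ?_, fun b hb hbN => ?_, hmem.2⟩
  · rw [hfF ζ.2]
    refine lp.ext (funext fun i => ?_)
    rw [hFi ζ hζ]
    simp [hG]
  · refine lp.ext (funext fun i => ?_)
    rw [← coord_apply, clm_taylorCoeff (coord i) (hmem.1.1 ζ ζ.2)]
    obtain ⟨q, hq, -, hqe⟩ := exists_exp_eq_one_add_pow_mul hN hh hω (l i)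
    have h1 : (fun z => coord i (f z)) =ᶠ[𝓝 (ζ : ℂ)]
        fun z => x i + (z - ζ) ^ N • (x i * q z) := by
      filter_upwards [hqe, Metric.isOpen_ball.mem_nhds ζ.2] with z hz hzd
      rw [coord_apply, hfF hzd, hFi z (disc_subset_closedBall hzd)]
      simp only [hG, hz, smul_eq_mul]
      ring
    rw [taylorCoeff_congr h1, taylorCoeff_const_add_pow_smul (by fun_prop) (x i) hb hbN]
    rfl

end Extremal

/-! ### Vanishing of the differentials for n + m ≤ N -/

section Vanishing

/-- `ω - ω(ζ)` is, near `ζ`, the product of `(z - ζ) ^ N` and the analytic function `h`. -/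
structure Config.IsFactor (ω : Config) (ζ : disc) (N : ℕ) (h : ℂ → ℂ) : Prop where
  one_le : 1 ≤ N
  analyticAt : AnalyticAt ℂ h ζ
  eq : (fun z => ω.toFun z - ω.toFun ζ) =ᶠ[𝓝 (ζ : ℂ)] fun z => (z - ζ) ^ N * h z

theorem Config.exists_isFactor (ω : Config) (ζ : disc) {k : ℕ}
    (hk : analyticOrderAt (deriv ω.toFun) (ζ : ℂ) = (k : ℕ∞)) :
    ∃ h, ω.IsFactor ζ (k + 1) h ∧ h ζ ≠ 0 := by
  have han := ω.analytic ζ (disc_subset_closedBall ζ.2)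
  have h1 := han.analyticOrderAt_deriv_add_one
  rw [hk] at h1
  have h2 : AnalyticAt ℂ (fun z => ω.toFun z - ω.toFun ζ) ζ := by fun_prop
  obtain ⟨h, hh, hh0, heq⟩ := (h2.analyticOrderAt_eq_natCast (n := k + 1)).1
    (by rw [← h1]; push_cast; rfl)
  exact ⟨h, ⟨by omega, hh, heq⟩, hh0⟩

variable {ω : Config} {ζ : disc}

theorem spaceZ_pow_mul_mem (ζ : disc) (n : ℕ) {f : ℂ → LInf} (hf : f ∈ (spaceZ ω).carrier) :
    (fun z => (z - (ζ : ℂ)) ^ n • f z) ∈ (spaceZ ω).carrier ∧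
      (spaceZ ω).norm (fun z => (z - (ζ : ℂ)) ^ n • f z) ≤ 2 ^ n * (spaceZ ω).norm f := by
  refine spaceZ_mul_mem hf (φ := fun z => (z - (ζ : ℂ)) ^ n) (ψ := fun z => (z - (ζ : ℂ)) ^ n)
    (by positivity) (by fun_prop) (by fun_prop) (fun _ _ => rfl) fun z hz => ?_
  have h1 : ‖z‖ = 1 := by simpa using hz
  have h2 := one_sub_norm_pos ζ
  have h3 := norm_sub_le z (ζ : ℂ)
  rw [norm_pow]
  exact pow_le_pow_left₀ (norm_nonneg _) (by linarith) n

theorem spaceZ_norm_add_le {f g : ℂ → LInf} (hf : f ∈ (spaceZ ω).carrier)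
    (hg : g ∈ (spaceZ ω).carrier) :
    (spaceZ ω).norm (f + g) ≤ (spaceZ ω).norm f + (spaceZ ω).norm g :=
  (spaceZ_isAdmissible ω).norm_add_le f hf g hg

theorem spaceZ_norm_sub_le {f g : ℂ → LInf} (hf : f ∈ (spaceZ ω).carrier)
    (hg : g ∈ (spaceZ ω).carrier) :
    (spaceZ ω).norm (f - g) ≤ (spaceZ ω).norm f + (spaceZ ω).norm g := by
  have h := spaceZ_norm_add_le hf ((spaceZ ω).carrier.smul_mem (-1) hg)
  rw [spaceZ_norm_smul _ hg] at h
  simpa [sub_eq_add_neg] using h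

theorem Config.IsFactor.exists_extremal {N : ℕ} {h : ℂ → ℂ} (H : ω.IsFactor ζ N h)
    {x : LInf} {r : ℝ} (hr : 0 ≤ r) (hx : lpNorm (ω.p ζ) x ≤ ENNReal.ofReal r)
    {K : ℝ} (hK : 1 < K) :
    ∃ f ∈ (spaceZ ω).carrier, f ζ = x ∧ (∀ a, 0 < a → a < N → taylorCoeff f ζ a = 0) ∧
      (spaceZ ω).norm f ≤ K * r :=
  spaceZ_exists_extremal ω ζ H.one_le H.analyticAt H.eq hr hx hK

/-- Below the order to which `ω` is constant at `ζ`, Taylor expansions can be truncated. -/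
theorem Config.IsFactor.exists_truncation {N : ℕ} {h : ℂ → ℂ} (H : ω.IsFactor ζ N h) {n : ℕ}
    (hn : n ≤ N) : ∃ C : ℝ, 0 ≤ C ∧ ∀ f ∈ (spaceZ ω).carrier, ∃ s ∈ (spaceZ ω).carrier,
      (∀ i < n, taylorCoeff s ζ i = taylorCoeff f ζ i) ∧
      (∀ i, n ≤ i → i < N → taylorCoeff s ζ i = 0) ∧
      (spaceZ ω).norm s ≤ C * (spaceZ ω).norm f := by
  induction n with
  | zero =>
    refine ⟨0, le_rfl, fun f _ => ⟨0, zero_mem _, fun i hi => absurd hi i.not_lt_zero,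
      fun i _ _ => ?_, ?_⟩⟩
    · simpa using taylorCoeff_smul (f := (0 : ℂ → LInf)) (z := (ζ : ℂ)) analyticAt_const 0 i
    · rw [((spaceZ_isAdmissible ω).norm_eq_zero 0 (zero_mem _)).2 rfl, zero_mul]
  | succ n ih =>
    obtain ⟨C, hC, ih⟩ := ih (by omega)
    have hpos := one_sub_norm_pos ζ
    set D : ℝ := (1 - ‖(ζ : ℂ)‖)⁻¹ ^ n with hD
    have hD0 : 0 ≤ D := by positivity
    -- Add to s the function (z - ζ)^n e, where e is extremal for the value at ζ of (f - s)/(z -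
    -- ζ)^n. The factors come from multiplication by (z - ζ)^n, the extremal constant 2, division,
    -- and ‖f - s‖.
    refine ⟨C + 2 ^ n * (2 * (D * (1 + C))), by positivity, fun f hf => ?_⟩
    obtain ⟨s, hs, hsl, hsz, hsn⟩ := ih f hf
    obtain ⟨g, hg, hgc, hgn⟩ := spaceZ_exists_pow_div ζ n (sub_mem hf hs) fun i hi => by
      rw [taylorCoeff_sub (hf.1 ζ ζ.2) (hs.1 ζ ζ.2), hsl i hi, sub_self]
    obtain ⟨e, he, heζ, hec, hen⟩ := H.exists_extremal (spaceZ_norm_nonneg g)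
      (spaceZ_lpNorm_apply_le hg ζ.2) one_lt_two
    obtain ⟨hpe, hpen⟩ := spaceZ_pow_mul_mem ζ n he
    have hadd : ∀ i, taylorCoeff (s + fun z => (z - (ζ : ℂ)) ^ n • e z) ζ i =
        taylorCoeff s ζ i + taylorCoeff (fun z => (z - (ζ : ℂ)) ^ n • e z) ζ i := fun i =>
      taylorCoeff_add (hs.1 ζ ζ.2) (hpe.1 ζ ζ.2) i
    refine ⟨_, add_mem hs hpe, fun i hi => ?_, fun i hi hiN => ?_, ?_⟩
    · rw [hadd]
      rcases Nat.lt_succ_iff_lt_or_eq.1 hi with hi | rfl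
      · rw [taylorCoeff_pow_smul_of_lt (he.1 ζ ζ.2) hi, hsl i hi, add_zero]
      · have h1 := taylorCoeff_pow_smul_add (he.1 ζ ζ.2) i 0
        have h2 := hgc 0
        rw [add_zero, taylorCoeff_zero] at h1 h2
        rw [h1, heζ, h2, taylorCoeff_sub (hf.1 ζ ζ.2) (hs.1 ζ ζ.2), add_sub_cancel]
    · obtain ⟨b, rfl⟩ := Nat.exists_eq_add_of_le (by omega : n ≤ i)
      rw [hadd, hsz _ (by omega) hiN, taylorCoeff_pow_smul_add (he.1 ζ ζ.2), zero_add]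
      exact hec b (by omega) (by omega)
    · have h1 := spaceZ_norm_sub_le hf hs
      calc (spaceZ ω).norm (s + fun z => (z - (ζ : ℂ)) ^ n • e z)
          ≤ C * (spaceZ ω).norm f +
              2 ^ n * (2 * (D * ((spaceZ ω).norm f + C * (spaceZ ω).norm f))) := by
            refine (spaceZ_norm_add_le hs hpe).trans (add_le_add hsn (hpen.trans ?_))
            gcongr
            refine hen.trans ?_
            gcongr
            refine hgn.trans ?_
            gcongr
            linarith
        _ = _ := by ring

theorem spaceZ_lpNorm_le_quotNorm {x : Fin 1 → LInf} (hx : x ∈ (spaceZ ω).space ζ 1) :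
    lpNorm (ω.p ζ) (x 0) ≤ ENNReal.ofReal ((spaceZ ω).quotNorm ζ 1 x) := by
  have key : ∀ f : (spaceZ ω).carrier, (spaceZ ω).jet ζ 1 f = x →
      lpNorm (ω.p ζ) (x 0) ≤ ENNReal.ofReal ((spaceZ ω).norm f) := by
    intro f hf
    have h1 : taylorCoeff (f : ℂ → LInf) ζ 0 = x 0 := congrFun hf 0
    rw [← h1, taylorCoeff_zero]
    exact spaceZ_lpNorm_apply_le f.2 ζ.2
  obtain ⟨f, hf⟩ := hx
  have hfin := ((key f hf).trans_lt ENNReal.ofReal_lt_top).ne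
  rw [← ENNReal.ofReal_toReal hfin]
  refine ENNReal.ofReal_le_ofReal (spaceZ_le_quotNorm ζ 1 ⟨f, hf⟩ fun g hg => ?_)
  exact ENNReal.toReal_le_of_le_ofReal (spaceZ_norm_nonneg _) (key g hg)

theorem jet_one_eq {F : FunctionSpace disc LInf} (f : F.carrier) {x : LInf}
    (h : (f : ℂ → LInf) ζ = x) : F.jet ζ 1 f = fun _ => x := by
  funext i
  have : (F.jet ζ 1 f) i = taylorCoeff (f : ℂ → LInf) ζ i := rfl
  rw [this, Fin.val_eq_zero, taylorCoeff_zero, h]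

/-- Point evaluation gives one inequality, extremal functions with K → 1 the other. -/
theorem Config.IsFactor.fibreIsLp {N : ℕ} {h : ℂ → ℂ} (H : ω.IsFactor ζ N h) :
    FibreIsLp (spaceZ ω) ζ (ω.p ζ) := by
  intro x
  have key : lpNorm (ω.p ζ) x < ∞ → ∀ K > 1, ∃ f : (spaceZ ω).carrier,
      (spaceZ ω).jet ζ 1 f = (fun _ => x) ∧
      (spaceZ ω).norm f ≤ K * (lpNorm (ω.p ζ) x).toReal := by
    intro hx K hK
    obtain ⟨f, hf, hfx, -, hfn⟩ := H.exists_extremal ENNReal.toReal_nonneg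
      (ENNReal.ofReal_toReal hx.ne).ge hK
    exact ⟨⟨f, hf⟩, jet_one_eq _ hfx, hfn⟩
  refine ⟨⟨fun hx => (spaceZ_lpNorm_le_quotNorm hx).trans_lt ENNReal.ofReal_lt_top, fun hx => ?_⟩,
    fun hx => ?_⟩
  · obtain ⟨f, hf, -⟩ := key hx 2 one_lt_two
    exact ⟨f, hf⟩
  · refine le_antisymm ?_ ?_
    · refine le_of_forall_gt_imp_ge_of_dense fun r hr => ?_
      rcases (ENNReal.toReal_nonneg (a := lpNorm (ω.p ζ) x)).eq_or_lt with h0 | h0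
      · obtain ⟨f, hf, hfn⟩ := key hx 2 one_lt_two
        have := spaceZ_quotNorm_le ζ 1 f hf
        rw [← h0] at hfn hr
        linarith
      · obtain ⟨f, hf, hfn⟩ := key hx (r / (lpNorm (ω.p ζ) x).toReal) ((one_lt_div h0).2 hr)
        rw [div_mul_cancel₀ _ h0.ne'] at hfn
        exact (spaceZ_quotNorm_le ζ 1 f hf).trans hfn
    · obtain ⟨f, hf, -⟩ := key hx 2 one_lt_two
      have h1 : (fun _ => x) ∈ (spaceZ ω).space ζ 1 := ⟨f, hf⟩
      have h2 := spaceZ_lpNorm_le_quotNorm h1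
      exact ENNReal.toReal_le_of_le_ofReal (spaceZ_quotNorm_nonneg _ _ _) h2

/-- Subtract from a selected function its truncation at order n, and divide by (z - ζ)^n: the m-jet
of the quotient is the differential, which is therefore bounded. Selecting truncations makes it
zero. For n = 1 the extremal functions are already truncated, so every C > 1 is allowed. -/
theorem Config.IsFactor.differentialVanishes {N : ℕ} {h : ℂ → ℂ} (H : ω.IsFactor ζ N h) {n m : ℕ}
    (hn : 1 ≤ n) (hm : 1 ≤ m) (hnm : n + m ≤ N) : (spaceZ ω).DifferentialVanishes ζ n m := by
  obtain ⟨D, hD, htr⟩ := H.exists_truncation (n := n) (by omega)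
  set Q : (spaceZ ω).carrier → Prop := fun f =>
    ∀ i, n ≤ i → i < N → taylorCoeff (f : ℂ → LInf) ζ i = 0 with hQ
  have hQs : ∀ (c : ℂ) f, Q f → Q (c • f) := fun c f hf i hi hiN => by
    rw [Submodule.coe_smul, taylorCoeff_smul (f.2.1 ζ ζ.2), hf i hi hiN, smul_zero]
  have hQ0 : Q 0 := fun i _ _ => by
    simpa using taylorCoeff_smul (f := (0 : ℂ → LInf)) (z := (ζ : ℂ)) analyticAt_const 0 i
  have hdiff : ∀ s : (spaceZ ω).space ζ n → (spaceZ ω).carrier, (∀ x, Q (s x)) →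
      ∀ x, (spaceZ ω).differential ζ n m s x = 0 := fun s hs x =>
    funext fun j => hs x _ (by omega) (by omega)
  refine ⟨fun C s hs => ?_, ?_, ?_⟩
  · refine ⟨(1 - ‖(ζ : ℂ)‖)⁻¹ ^ n * ((1 + D) * C), fun x => ?_⟩
    have hf := (s x).2
    obtain ⟨e, he, hel, hez, hen⟩ := htr _ hf
    obtain ⟨g, hg, hgc, hgn⟩ := spaceZ_exists_pow_div ζ n (sub_mem hf he) fun i hi => by
      rw [taylorCoeff_sub (hf.1 ζ ζ.2) (he.1 ζ ζ.2), hel i hi, sub_self]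
    have hjet : (spaceZ ω).jet ζ m ⟨g, hg⟩ = (spaceZ ω).differential ζ n m s x := by
      funext j
      refine (hgc j).trans ?_
      rw [taylorCoeff_sub (hf.1 ζ ζ.2) (he.1 ζ ζ.2), hez _ (by omega) (by omega), sub_zero]
      rfl
    refine ⟨⟨_, hjet⟩, (spaceZ_quotNorm_le ζ m _ hjet).trans (hgn.trans ?_)⟩
    have hpos := one_sub_norm_pos ζ
    have h1 := spaceZ_norm_sub_le hf he
    rw [mul_assoc]
    gcongr
    calc (spaceZ ω).norm ((s x : ℂ → LInf) - e) ≤ (1 + D) * (spaceZ ω).norm (s x) := by linarith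
      _ ≤ (1 + D) * (C * (spaceZ ω).quotNorm ζ n x) := by
        gcongr
        exact hs.norm_le x
      _ = _ := by ring
  · obtain ⟨s, hs, hsQ⟩ := spaceZ_exists_isSelection ζ n (C := D * 2) (by positivity) Q hQ0 hQs
      fun x hx hx0 => by
        have hq := spaceZ_quotNorm_pos ζ n hx hx0
        obtain ⟨f, hf, hfn⟩ := spaceZ_exists_lt_of_quotNorm_lt ζ n hx
          (r := 2 * (spaceZ ω).quotNorm ζ n x) (by linarith)
        obtain ⟨e, he, hel, hez, hen⟩ := htr _ f.2
        refine ⟨⟨e, he⟩, ?_, hez, hen.trans ?_⟩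
        · rw [← hf]
          exact funext fun i => hel i i.2
        · rw [mul_assoc]
          gcongr
    exact ⟨D * 2, s, hs, hdiff s hsQ⟩
  · rintro rfl C hC
    obtain ⟨s, hs, hsQ⟩ := spaceZ_exists_isSelection ζ 1 (zero_le_one.trans hC.le) Q hQ0 hQs
      fun x hx hx0 => by
        obtain ⟨f, hf, hfx, hfc, hfn⟩ := H.exists_extremal (spaceZ_quotNorm_nonneg _ _ _)
          (spaceZ_lpNorm_le_quotNorm hx) hC
        refine ⟨⟨f, hf⟩, ?_, fun i hi hiN => hfc i (by omega) hiN, hfn⟩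
        rw [jet_one_eq (ζ := ζ) _ hfx]
        funext i
        rw [Subsingleton.elim 0 i]
    exact ⟨s, hs, hdiff s hsQ⟩

end Vanishing

/-! ### Averaging over signs -/

section Signs

/-- The mean of ε_i ε_k over independent signs is 1 if i = k and 0 otherwise. The induction averages
over one sign at a time. -/
theorem norm_add_sum_diag_le {S : Finset ℕ} {M : ℕ → ℕ → ℂ} {α : ℂ} {K : ℝ}
    (h : ∀ ε : ℕ → ℂ, (∀ i, ε i = 1 ∨ ε i = -1) →
      ‖α + ∑ i ∈ S, ∑ k ∈ S, ε i * ε k * M i k‖ ≤ K) :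
    ‖α + ∑ i ∈ S, M i i‖ ≤ K := by
  classical
  induction S using Finset.induction_on generalizing α with
  | empty => simpa using h (fun _ => 1) fun _ => Or.inl rfl
  | insert a T ha ih =>
    rw [Finset.sum_insert ha, ← add_assoc]
    refine ih fun ε hε => ?_
    -- Since e² = 1, the double sum is affine in the sign e at a; the mean over e = ±1 removes the
    -- linear part.
    have key : ∀ e : ℂ, e * e = 1 →
        ∑ i ∈ insert a T, ∑ k ∈ insert a T,
          Function.update ε a e i * Function.update ε a e k * M i k =
        M a a + ∑ i ∈ T, ∑ k ∈ T, ε i * ε k * M i k +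
          e * (∑ k ∈ T, ε k * M a k + ∑ i ∈ T, ε i * M i a) := by
      intro e he
      have hne : ∀ i ∈ T, Function.update ε a e i = ε i := fun i hi =>
        Function.update_of_ne (ne_of_mem_of_not_mem hi ha) _ _
      rw [Finset.sum_insert ha, Finset.sum_insert ha, Function.update_self, he]
      have h1 : ∑ k ∈ T, e * Function.update ε a e k * M a k = e * ∑ k ∈ T, ε k * M a k := by
        rw [Finset.mul_sum]
        exact Finset.sum_congr rfl fun k hk => by rw [hne k hk, mul_assoc]
      have h2 : ∑ i ∈ T, ∑ k ∈ insert a T,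
          Function.update ε a e i * Function.update ε a e k * M i k =
          e * ∑ i ∈ T, ε i * M i a + ∑ i ∈ T, ∑ k ∈ T, ε i * ε k * M i k := by
        rw [Finset.mul_sum, ← Finset.sum_add_distrib]
        refine Finset.sum_congr rfl fun i hi => ?_
        rw [Finset.sum_insert ha, Function.update_self, hne i hi]
        congr 1
        · ring
        · exact Finset.sum_congr rfl fun k hk => by rw [hne k hk]
      rw [h1, h2]
      ring
    have hupd : ∀ e : ℂ, (e = 1 ∨ e = -1) → ∀ i, Function.update ε a e i = 1 ∨
        Function.update ε a e i = -1 := by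
      intro e he i
      by_cases hi : i = a
      · subst hi; simpa using he
      · simpa [Function.update_of_ne hi] using hε i
    have hp := h _ (hupd 1 (Or.inl rfl))
    have hm := h _ (hupd (-1) (Or.inr rfl))
    rw [key 1 (by ring)] at hp
    rw [key (-1) (by ring)] at hm
    have h3 := (norm_add_le _ _).trans (add_le_add hp hm)
    have h4 : ∀ x y z w : ℂ, x + (y + z + 1 * w) + (x + (y + z + -1 * w)) = 2 * (x + y + z) := by
      intros; ring
    rw [h4, norm_mul, Complex.norm_ofNat] at h3
    linarith

end Signs

/-! ### Nontriviality of the differentials for n + m ≥ N + 1 -/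

section Nontrivial

/-- The functional `x ↦ |S|⁻¹ ∑ ε_i x_i`, the sum being over `i ∈ S`. -/
def signedMean (S : Finset ℕ) (ε : ℕ → ℂ) : LInf →L[ℂ] ℂ :=
  (S.card : ℂ)⁻¹ • ∑ i ∈ S, ε i • coord i

theorem signedMean_apply (S : Finset ℕ) (ε : ℕ → ℂ) (x : LInf) :
    signedMean S ε x = (S.card : ℂ)⁻¹ * ∑ i ∈ S, ε i * x i := by
  simp [signedMean, coord_apply]

/-- The finitely supported sequence with values `ε_i`, `i ∈ S`. -/
def signVec (S : Finset ℕ) (ε : ℕ → ℂ) : LInf := ∑ i ∈ S, ε i • lp.single ∞ i (1 : ℂ)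

theorem signVec_apply (S : Finset ℕ) (ε : ℕ → ℂ) (i : ℕ) :
    signVec S ε i = if i ∈ S then ε i else 0 := by
  rw [signVec, ← coord_apply, map_sum]
  simp only [map_smul, coord_apply, lp.single_apply, smul_eq_mul, Pi.single_apply]
  simp

theorem signedMean_signVec {S : Finset ℕ} (hS : S.Nonempty) {ε : ℕ → ℂ}
    (hε : ∀ i, ε i = 1 ∨ ε i = -1) : signedMean S ε (signVec S ε) = 1 := by
  have h : ∀ i ∈ S, ε i * signVec S ε i = 1 := fun i hi => by
    rw [signVec_apply, if_pos hi]
    rcases hε i with h | h <;> rw [h] <;> ring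
  have hc : (S.card : ℂ) ≠ 0 := by exact_mod_cast hS.card_pos.ne'
  rw [signedMean_apply, Finset.sum_congr rfl h]
  simp [hc]

variable {ω : Config} {ζ : disc}

/-- The scalar function `|S| ^ (ω(z) - ω(ζ))`. -/
def cardPow (ω : Config) (ζ : disc) (S : Finset ℕ) (z : ℂ) : ℂ :=
  Complex.exp (Real.log S.card * (ω.toFun z - ω.toFun ζ))

theorem differentiableOn_cardPow (ω : Config) (ζ : disc) (S : Finset ℕ) :
    DifferentiableOn ℂ (cardPow ω ζ S) disc :=
  DifferentiableOn.cexp ((ω.differentiableOn.sub (differentiableOn_const _)).const_mul _)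

/-- Up to the constant |S|^(-ω(ζ)), the product is the pairing with the uniform weights b_i = 1/|S|:
the factor |S|^ω(z) offsets the changing exponent, and the bound is uniform on the disc. -/
theorem spaceZ_norm_cardPow_mul_signedMean_le {S : Finset ℕ} (hS : S.Nonempty) {ε : ℕ → ℂ}
    (hε : ∀ i, ‖ε i‖ = 1) {g : ℂ → LInf} (hg : g ∈ (spaceZ ω).carrier) {z : ℂ} (hz : z ∈ disc) :
    ‖cardPow ω ζ S z * signedMean S ε (g z)‖ ≤
      (spaceZ ω).norm g * ((S.card : ℝ) ^ (ω.toFun ζ).re)⁻¹ := by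
  have hd : (0 : ℝ) < S.card := by exact_mod_cast hS.card_pos
  have h1 := norm_pairing_le ω (S := S) (b := fun _ => (S.card : ℝ)⁻¹) (u := ε)
    (fun i _ => inv_pos.2 hd) (by simp [hd.ne']) hε (disc_subset_closedBall hz)
    (spaceZ_norm_nonneg g) (spaceZ_lpNorm_apply_le hg hz)
  have h2 : cardPow ω ζ S z * signedMean S ε (g z) =
      Complex.exp (Real.log S.card * (-ω.toFun ζ)) *
        pairing ω S (fun _ => (S.card : ℝ)⁻¹) ε z (g z) := by
    have h3 : (S.card : ℂ)⁻¹ = Complex.exp (-(Real.log S.card : ℂ)) := by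
      rw [← Complex.ofReal_neg, ← Complex.ofReal_exp, Real.exp_neg, Real.exp_log hd]
      push_cast
      rfl
    rw [signedMean_apply, pairing, cardPow, Finset.mul_sum, Finset.mul_sum, Finset.mul_sum, h3]
    refine Finset.sum_congr rfl fun i _ => ?_
    rw [coord_apply, Real.log_inv, Complex.ofReal_neg]
    have h4 : Complex.exp (Real.log S.card * (ω.toFun z - ω.toFun ζ)) *
        Complex.exp (-(Real.log S.card : ℂ)) = Complex.exp (Real.log S.card * (-ω.toFun ζ)) *
          Complex.exp (-(Real.log S.card : ℂ) * (1 - ω.toFun z)) := by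
      rw [← Complex.exp_add, ← Complex.exp_add]
      congr 1
      ring
    linear_combination (ε i * g z i) * h4
  rw [h2, norm_mul, norm_exp_log_mul hd, Complex.neg_re, Real.rpow_neg hd.le, mul_comm]
  gcongr

theorem spaceZ_norm_taylorCoeff_cardPow_mul_le (ω : Config) (ζ : disc) (a : ℕ) :
    ∃ K : ℝ, 0 ≤ K ∧ ∀ (S : Finset ℕ) (ε : ℕ → ℂ), S.Nonempty → (∀ i, ‖ε i‖ = 1) →
      ∀ g ∈ (spaceZ ω).carrier,
        ‖taylorCoeff (fun z => cardPow ω ζ S z * signedMean S ε (g z)) ζ a‖ ≤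
          K * ((spaceZ ω).norm g * ((S.card : ℝ) ^ (ω.toFun ζ).re)⁻¹) := by
  obtain ⟨K, hK, h⟩ := norm_taylorCoeff_le (E := ℂ) ζ.2 a
  refine ⟨K, hK, fun S ε hS hε g hg => h _ _ ?_ fun z hz =>
    spaceZ_norm_cardPow_mul_signedMean_le hS hε hg hz⟩
  exact (differentiableOn_cardPow ω ζ S).mul
    ((signedMean S ε).differentiable.comp_differentiableOn (spaceZ_differentiableOn hg))

variable {N : ℕ} {h : ℂ → ℂ}

theorem Config.IsFactor.cardPow_eq (H : ω.IsFactor ζ N h) (S : Finset ℕ) :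
    ∃ r : ℂ → ℂ, AnalyticAt ℂ r ζ ∧ r ζ = Real.log S.card * h ζ ∧
      cardPow ω ζ S =ᶠ[𝓝 (ζ : ℂ)] fun z => 1 + (z - ζ) ^ N * r z :=
  exists_exp_eq_one_add_pow_mul H.one_le H.analyticAt H.eq _

theorem Config.IsFactor.taylorCoeff_cardPow_mul_of_lt (H : ω.IsFactor ζ N h) (S : Finset ℕ)
    {g : ℂ → ℂ} (hg : AnalyticAt ℂ g ζ) {a : ℕ} (ha : a < N) :
    taylorCoeff (fun z => cardPow ω ζ S z * g z) ζ a = taylorCoeff g ζ a := by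
  obtain ⟨r, hr, -, hqe⟩ := H.cardPow_eq S
  have h1 : (fun z => cardPow ω ζ S z * g z) =ᶠ[𝓝 (ζ : ℂ)]
      g + fun z => (z - (ζ : ℂ)) ^ N • (r z * g z) := by
    filter_upwards [hqe] with z hz
    simp only [hz, Pi.add_apply, smul_eq_mul]
    ring
  rw [taylorCoeff_congr h1, taylorCoeff_add hg (by fun_prop),
    taylorCoeff_pow_smul_of_lt (by fun_prop) ha, add_zero]

/-- Here `cardPow` is 1 + (z - ζ)^N r. As g vanishes to order j, the correction (z - ζ)^N r g first
acts at order N + j, through r(ζ) times the leading coefficient of g. -/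
theorem Config.IsFactor.taylorCoeff_cardPow_mul (H : ω.IsFactor ζ N h) (S : Finset ℕ)
    {g : ℂ → ℂ} (hg : AnalyticAt ℂ g ζ) {j : ℕ} (hj : ∀ i < j, taylorCoeff g ζ i = 0) :
    taylorCoeff (fun z => cardPow ω ζ S z * g z) ζ (N + j) =
      taylorCoeff g ζ (N + j) + Real.log S.card * h ζ * taylorCoeff g ζ j := by
  obtain ⟨r, hr, hrζ, hqe⟩ := H.cardPow_eq S
  have h1 : (fun z => cardPow ω ζ S z * g z) =ᶠ[𝓝 (ζ : ℂ)]
      g + fun z => (z - (ζ : ℂ)) ^ N • (r z * g z) := by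
    filter_upwards [hqe] with z hz
    simp only [hz, Pi.add_apply, smul_eq_mul]
    ring
  obtain ⟨u, hu, hgu⟩ := exists_eq_pow_smul hg hj
  have h2 : (fun z => r z * g z) =ᶠ[𝓝 (ζ : ℂ)] fun z => (z - ζ) ^ j • (r z * u z) := by
    filter_upwards [hgu] with z hz
    simp only [hz, smul_eq_mul]
    ring
  have h3 := taylorCoeff_pow_smul_add (g := fun z => r z * u z) (c := (ζ : ℂ)) (by fun_prop) j 0
  have h4 := taylorCoeff_pow_smul_add hu j 0
  rw [add_zero, taylorCoeff_zero] at h3 h4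
  rw [taylorCoeff_congr h1, taylorCoeff_add hg (by fun_prop),
    taylorCoeff_pow_smul_add (by fun_prop), taylorCoeff_congr h2, h3, taylorCoeff_congr hgu j, h4,
    hrζ]

/-- The jets `(0, …, 0, v, 0, …, 0)` of finitely supported sign sequences `v`. -/
theorem Config.IsFactor.exists_signVec_extension (H : ω.IsFactor ζ N h) {n : ℕ} (j : Fin n)
    (hj : n ≤ N + j) {S : Finset ℕ} (hS : S.Nonempty) {ε : ℕ → ℂ} (hε : ∀ i, ‖ε i‖ = 1) :
    ∃ f : (spaceZ ω).carrier, (spaceZ ω).jet ζ n f = Pi.single j (signVec S ε) ∧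
      (spaceZ ω).norm f ≤ 2 ^ (j : ℕ) * (S.card : ℝ) ^ (ω.toFun ζ).re := by
  classical
  have hd : (0 : ℝ) < S.card := by exact_mod_cast hS.card_pos
  set v := signVec S ε with hv
  -- The function |S|^(ω(ζ)-ω(z)), extremal for vectors of constant modulus on S; finite support
  -- makes null weights unnecessary.
  set G : ℂ → ℂ := fun z =>
    Complex.exp ((-Real.log S.card : ℝ) * (ω.toFun z - ω.toFun ζ)) with hG
  have hGn : ∀ z, ‖G z‖ = (S.card : ℝ) ^ (ω.toFun ζ).re * ((S.card : ℝ)⁻¹) ^ (ω.toFun z).re := by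
    intro z
    have h1 : G z = Complex.exp (Real.log S.card * (ω.toFun ζ - ω.toFun z)) := by
      simp only [hG]
      congr 1
      push_cast
      ring
    rw [h1, norm_exp_log_mul hd, Complex.sub_re, Real.rpow_sub hd, Real.inv_rpow hd.le,
      div_eq_mul_inv]
  have hGc : ContinuousOn G (Metric.closedBall 0 1) :=
    Complex.continuous_exp.comp_continuousOn
      (continuousOn_const.mul (ω.continuousOn.sub continuousOn_const))
  have hGd : DifferentiableOn ℂ G disc :=
    DifferentiableOn.cexp ((ω.differentiableOn.sub (differentiableOn_const _)).const_mul _)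
  set f₀ : ℂ → LInf := fun z => if z ∈ disc then G z • v else 0 with hf₀
  have hmem := spaceZ_mem (ω := ω) (f := f₀) (F := fun z => G z • v)
    (R := (S.card : ℝ) ^ (ω.toFun ζ).re) (by positivity) (hGc.smul continuousOn_const)
    (hGd.smul_const v) (fun z hz => by simp only [hf₀, if_pos hz])
    (fun z hz => by simp only [hf₀, if_neg hz]) (fun z hz => by
      have hz' := Metric.sphere_subset_closedBall hz
      rw [ω.lpNorm_le_iff hz' (by positivity)]
      intro T b hb hs
      have h1 : ∀ i, ‖(G z • v) i‖ = if i ∈ S then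
          (S.card : ℝ) ^ (ω.toFun ζ).re * ((S.card : ℝ)⁻¹) ^ (ω.toFun z).re else 0 := by
        intro i
        rw [lp.coeFn_smul, Pi.smul_apply, norm_smul, hGn, hv, signVec_apply]
        by_cases hi : i ∈ S
        · simp [hi, hε i]
        · simp [hi]
      simp only [h1, ite_mul, zero_mul]
      rw [← Finset.sum_filter]
      simp only [mul_assoc]
      rw [← Finset.mul_sum]
      have h2 := sum_rpow_mul_rpow_le_one (ω.re_mem_Icc hz').1 (ω.re_mem_Icc hz').2
        (S := T.filter (· ∈ S)) (a := fun _ => (S.card : ℝ)⁻¹) (b := b)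
        (fun _ => by positivity) hb (by
          rw [Finset.sum_const, nsmul_eq_mul, ← div_eq_mul_inv]
          refine div_le_one_of_le₀ ?_ hd.le
          exact_mod_cast Finset.card_le_card fun i hi => (Finset.mem_filter.1 hi).2)
        ((Finset.sum_le_sum_of_subset_of_nonneg (Finset.filter_subset _ _)
          fun i _ _ => hb i).trans hs)
      exact (mul_le_mul_of_nonneg_left h2 (by positivity)).trans (mul_one _).le)
  obtain ⟨hf, hfn⟩ := spaceZ_pow_mul_mem ζ j hmem.1
  refine ⟨⟨_, hf⟩, ?_, hfn.trans (by gcongr; exact hmem.2)⟩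
  obtain ⟨r, hr, -, hqe⟩ := exists_exp_eq_one_add_pow_mul H.one_le H.analyticAt H.eq
    ((-Real.log S.card : ℝ) : ℂ)
  have h1 : f₀ =ᶠ[𝓝 (ζ : ℂ)] fun z => v + (z - ζ) ^ N • (r z • v) := by
    filter_upwards [hqe, Metric.isOpen_ball.mem_nhds ζ.2] with z hz hzd
    simp only [hf₀, if_pos hzd, hG, hz, add_smul, one_smul, mul_smul]
  funext i
  change taylorCoeff (fun z => (z - (ζ : ℂ)) ^ (j : ℕ) • f₀ z) ζ i = _
  rcases lt_trichotomy i j with hij | rfl | hij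
  · rw [taylorCoeff_pow_smul_of_lt (hmem.1.1 ζ ζ.2) hij, Pi.single_eq_of_ne hij.ne]
  · have h2 := taylorCoeff_pow_smul_add (hmem.1.1 ζ ζ.2) i 0
    rw [add_zero, taylorCoeff_zero] at h2
    rw [h2, Pi.single_eq_same, h1.eq_of_nhds]
    simp [zero_pow (by have := H.one_le; omega : N ≠ 0)]
  · have hij' : (j : ℕ) < i := hij
    obtain ⟨b, hb⟩ := Nat.exists_eq_add_of_lt hij'
    have hi := i.2
    rw [hb, add_assoc, taylorCoeff_pow_smul_add (hmem.1.1 ζ ζ.2), Pi.single_eq_of_ne hij.ne',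
      taylorCoeff_congr h1, taylorCoeff_const_add_pow_smul (by fun_prop) v (by omega) (by omega)]

/-- Vectors of signs in the j-th entry are tested. The selected function contributes log|S| h(ζ) at
order N + j, the bounded part contributes no logarithm, and L must absorb it; a linear map cannot do
so for all signs. -/
theorem Config.IsFactor.differentialNontrivial (H : ω.IsFactor ζ N h) (h0 : h ζ ≠ 0) {n m : ℕ}
    (hn : 1 ≤ n) (hm : 1 ≤ m) (hnm : N + 1 ≤ n + m) :
    (spaceZ ω).DifferentialNontrivial ζ n m := by
  classical
  refine ⟨fun C hC => spaceZ_exists_isSelection_of_one_lt ζ n hC, fun C s hs => ?_⟩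
  rintro ⟨L, M, hLM⟩
  have hN := H.one_le
  -- The order N + j must be one of n, …, n + m - 1 to be visible in the differential, and its
  -- position N + j - n must be below N, so that `cardPow` leaves the bounded part unchanged.
  obtain ⟨j, hj1, hj2⟩ : ∃ j : Fin n, n ≤ N + j ∧ N + j - n < min N m := by
    rcases le_total n N with hle | hle
    · exact ⟨⟨0, hn⟩, by simpa using hle, by simp only [lt_min_iff]; omega⟩
    · exact ⟨⟨n - N, by omega⟩, by simp only; omega, by simp only [lt_min_iff]; omega⟩
  obtain ⟨hi₀N, hi₀m⟩ := lt_min_iff.1 hj2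
  set i₀ : Fin m := ⟨N + j - n, hi₀m⟩ with hi₀
  obtain ⟨A, hA, hAb⟩ := spaceZ_norm_taylorCoeff_cardPow_mul_le ω ζ (N + j)
  obtain ⟨B, hB, hBb⟩ := spaceZ_norm_taylorCoeff_cardPow_mul_le ω ζ i₀
  have hex : ∀ i : ℕ, (Pi.single j (lp.single ∞ i (1 : ℂ)) : Fin n → LInf) ∈
      (spaceZ ω).space ζ n := by
    intro i
    obtain ⟨f, hf, -⟩ := H.exists_signVec_extension j hj1 (Finset.singleton_nonempty i)
      (ε := fun _ => 1) (fun _ => norm_one)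
    refine ⟨f, hf.trans ?_⟩
    simp [signVec]
  set x : ℕ → (spaceZ ω).space ζ n := fun i => ⟨_, hex i⟩ with hx
  set K : ℝ := A * (|C| * 2 ^ (j : ℕ)) + B * (|M| * 2 ^ (j : ℕ) + 1) with hK
  have core : ∀ (S : Finset ℕ) (ε : ℕ → ℂ), S.Nonempty → (∀ i, ε i = 1 ∨ ε i = -1) →
      ‖Real.log S.card * h ζ + signedMean S ε (L (∑ i ∈ S, ε i • x i) i₀)‖ ≤ K := by
    intro S ε hS hε
    have hε1 : ∀ i, ‖ε i‖ = 1 := fun i => by rcases hε i with h | h <;> simp [h]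
    set X := ∑ i ∈ S, ε i • x i with hX
    have hXv : (X : Fin n → LInf) = Pi.single j (signVec S ε) := by
      have h1 : (X : Fin n → LInf) = ∑ i ∈ S, ε i • Pi.single j (lp.single ∞ i (1 : ℂ)) := by
        simp [hX, hx]
      rw [h1, signVec, ← LinearMap.coe_single (R := ℂ) (φ := fun _ : Fin n => LInf) j, map_sum]
      simp only [map_smul]
    set d : ℝ := (S.card : ℝ) ^ (ω.toFun ζ).re with hd
    have hd0 : 0 < d := by
      have : (0 : ℝ) < S.card := by exact_mod_cast hS.card_pos
      positivity
    have hXq : (spaceZ ω).quotNorm ζ n X ≤ 2 ^ (j : ℕ) * d := by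
      obtain ⟨f, hf, hfn⟩ := H.exists_signVec_extension j hj1 hS hε1
      exact (spaceZ_quotNorm_le ζ n f (hf.trans hXv.symm)).trans hfn
    have hXq0 := spaceZ_quotNorm_nonneg (ω := ω) ζ n X
    have hg := (s X).2
    set g : ℂ → LInf := (s X : ℂ → LInf) with hgdef
    have hgn : (spaceZ ω).norm g ≤ |C| * 2 ^ (j : ℕ) * d := by
      refine (hs.norm_le X).trans ?_
      rw [mul_assoc]
      exact mul_le_mul (le_abs_self C) hXq hXq0 (abs_nonneg C)
    have hgj : ∀ i : Fin n, taylorCoeff g ζ i = (Pi.single j (signVec S ε) : Fin n → LInf) i :=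
      fun i => by
        rw [← hXv]
        exact congrFun (hs.jet_eq X) i
    have hgan := hg.1 ζ ζ.2
    have hTg : ∀ a, taylorCoeff (fun z => signedMean S ε (g z)) ζ a =
        signedMean S ε (taylorCoeff g ζ a) := fun a => (clm_taylorCoeff _ hgan a).symm
    have han : AnalyticAt ℂ (fun z => signedMean S ε (g z)) ζ :=
      ((signedMean S ε).analyticAt _).fun_comp hgan
    -- Entries before j vanish and the signed mean of the j-th entry is 1, so the logarithm appears
    -- with the coefficient h(ζ).
    have e1 := H.taylorCoeff_cardPow_mul S han (j := j) fun i hi => by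
      rw [hTg, hgj ⟨i, hi.trans j.2⟩, Pi.single_eq_of_ne, map_zero]
      exact fun h => hi.ne (congrArg Fin.val h)
    rw [hTg, hTg, hgj j, Pi.single_eq_same, signedMean_signVec hS hε, mul_one] at e1
    have b1 := hAb S ε hS hε1 g hg
    rw [e1] at b1
    have b1' : A * ((spaceZ ω).norm g * d⁻¹) ≤ A * (|C| * 2 ^ (j : ℕ)) := by
      refine mul_le_mul_of_nonneg_left ?_ hA
      rwa [← div_eq_mul_inv, div_le_iff₀ hd0]
    obtain ⟨hmem, hq⟩ := hLM X
    -- A function realising the jet Ω(X) - L(X); the summand 1 makes the inequality strict.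
    obtain ⟨g', hg', hgn'⟩ := spaceZ_exists_lt_of_quotNorm_lt ζ m hmem
      (r := (|M| * 2 ^ (j : ℕ) + 1) * d) (by
        refine hq.trans_lt ?_
        have : M * (spaceZ ω).quotNorm ζ n X ≤ |M| * (2 ^ (j : ℕ) * d) :=
          mul_le_mul (le_abs_self M) hXq hXq0 (abs_nonneg M)
        linarith)
    have hgan' := g'.2.1 ζ ζ.2
    have han' : AnalyticAt ℂ (fun z => signedMean S ε ((g' : ℂ → LInf) z)) ζ :=
      ((signedMean S ε).analyticAt _).fun_comp hgan'
    have e2 := H.taylorCoeff_cardPow_mul_of_lt S han' hi₀N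
    have e3 : taylorCoeff (g' : ℂ → LInf) ζ i₀ = taylorCoeff g ζ (N + j) - L X i₀ := by
      have := congrFun hg' i₀
      refine this.trans ?_
      have h5 : n + (i₀ : ℕ) = N + j := by simp only [hi₀]; omega
      simp only [Pi.sub_apply, FunctionSpace.differential, h5]
      rfl
    have e4 := (clm_taylorCoeff (signedMean S ε) hgan' i₀).symm
    rw [e3, map_sub] at e4
    have b2 := hBb S ε hS hε1 g' g'.2
    rw [show taylorCoeff (fun z => cardPow ω ζ S z * signedMean S ε ((g' : ℂ → LInf) z)) ζ i₀ =
      _ from e2.trans e4] at b2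
    have b2' : B * ((spaceZ ω).norm g' * d⁻¹) ≤ B * (|M| * 2 ^ (j : ℕ) + 1) := by
      refine mul_le_mul_of_nonneg_left ?_ hB
      rw [← div_eq_mul_inv, div_le_iff₀ hd0]
      exact hgn'.le
    -- The unknown coefficient of g of order N + j cancels in the difference, leaving only the
    -- logarithm and L.
    have h6 := norm_sub_le_of_le (b1.trans b1') (b2.trans b2')
    refine le_trans (le_of_eq ?_) h6
    congr 1
    ring
  set D : ℕ → ℕ → ℂ := fun i k => L (x k) i₀ i with hD
  have hsum : ∀ (S : Finset ℕ) (ε : ℕ → ℂ), (S.card : ℂ) ≠ 0 →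
      S.card * signedMean S ε (L (∑ i ∈ S, ε i • x i) i₀) =
        ∑ i ∈ S, ∑ k ∈ S, ε i * ε k * D i k := by
    intro S ε hc
    rw [signedMean_apply, mul_inv_cancel_left₀ hc]
    refine Finset.sum_congr rfl fun i _ => ?_
    rw [map_sum, Finset.sum_apply, ← coord_apply, map_sum, Finset.mul_sum]
    refine Finset.sum_congr rfl fun k _ => ?_
    rw [map_smul, Pi.smul_apply, map_smul, smul_eq_mul, mul_assoc]
    rfl
  -- For singletons log|S| = 0, so the estimate bounds the diagonal of L itself.
  have hdiag : ∀ i, ‖D i i‖ ≤ K := by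
    intro i
    have h1 := core {i} (fun _ => 1) (Finset.singleton_nonempty i) fun _ => Or.inl rfl
    have h2 := hsum {i} (fun _ => 1) (by simp)
    simp only [Finset.card_singleton, Nat.cast_one, one_mul, Finset.sum_singleton] at h1 h2
    rw [h2] at h1
    simpa using h1
  have hbound : ∀ d : ℕ, 1 ≤ d → Real.log d * ‖h ζ‖ ≤ 2 * K := by
    intro d hd
    have hd0 : (0 : ℝ) < d := by exact_mod_cast hd
    have hdc : ((Finset.range d).card : ℂ) ≠ 0 := by
      rw [Finset.card_range]
      exact_mod_cast (by omega : d ≠ 0)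
    have h1 := norm_add_sum_diag_le (S := Finset.range d) (M := D)
      (α := d * (Real.log d * h ζ)) (K := d * K) fun ε hε => by
        have h2 := core (Finset.range d) ε (Finset.nonempty_range_iff.2 (by omega)) hε
        rw [← hsum _ ε hdc, Finset.card_range, ← mul_add, norm_mul, Complex.norm_natCast]
        rw [Finset.card_range] at h2
        gcongr
    have h3 : ‖∑ i ∈ Finset.range d, D i i‖ ≤ d * K := by
      refine (norm_sum_le _ _).trans ((Finset.sum_le_sum fun i _ => hdiag i).trans ?_)
      simp
    have h4 := norm_sub_le_of_le h1 h3
    rw [add_sub_cancel_right, norm_mul, norm_mul, Complex.norm_natCast, Complex.norm_real,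
      Real.norm_of_nonneg (Real.log_natCast_nonneg d)] at h4
    have h5 : (d : ℝ) * (Real.log d * ‖h ζ‖) ≤ d * (2 * K) := by linarith
    exact le_of_mul_le_mul_left h5 hd0
  have hpos : 0 < ‖h ζ‖ := norm_pos_iff.2 h0
  have htend := Real.tendsto_log_atTop.comp tendsto_natCast_atTop_atTop
  obtain ⟨d, hd1, hd2⟩ := ((tendsto_atTop.1 htend (2 * K / ‖h ζ‖ + 1)).and
    (eventually_ge_atTop 1)).exists
  have h1 := hbound d hd2
  rw [← le_div_iff₀ hpos] at h1
  simp only [Function.comp] at hd1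
  linarith

end Nontrivial

/-! ### The examples ω(z) = 1/2 + z^N/2 at the origin -/

section Examples

/-- The function `1 / 2 + z ^ N / 2`. -/
def powConfig (N : ℕ) (hN : 1 ≤ N) : Config where
  toFun z := 1 / 2 + z ^ N / 2
  analytic z _ := by fun_prop
  mapsTo z hz := by
    have h1 : ‖z ^ N‖ < 1 := by
      rw [norm_pow]
      exact pow_lt_one₀ (norm_nonneg _) (by simpa using hz) (by omega)
    have h2 := abs_lt.1 ((Complex.abs_re_le_norm (z ^ N)).trans_lt h1)
    have h3 : (1 / 2 + z ^ N / 2 : ℂ).re = 1 / 2 + (z ^ N).re / 2 := by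
      simp
    constructor <;> rw [h3] <;> linarith

/-- The centre of the disc. -/
def discZero : disc := ⟨0, by simp⟩

theorem powConfig_p (N : ℕ) (hN : 1 ≤ N) : (powConfig N hN).p discZero = 2 := by
  have h : ((powConfig N hN).toFun discZero).re = 2⁻¹ := by
    simp [powConfig, discZero, zero_pow (by omega : N ≠ 0)]
  rw [Config.p, h, ENNReal.ofReal_inv_of_pos two_pos, inv_inv, ENNReal.ofReal_ofNat]

theorem powConfig_isFactor (N : ℕ) (hN : 1 ≤ N) :
    (powConfig N hN).IsFactor discZero N fun _ => 1 / 2 where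
  one_le := hN
  analyticAt := analyticAt_const
  eq := Eventually.of_forall fun z => by
    simp [powConfig, discZero, zero_pow (by omega : N ≠ 0), div_eq_mul_inv]

end Examples

end Rochberg

end

theorem mainTheorem11 :
    (∀ (ω : Rochberg.Config),
      (Rochberg.spaceZ ω).IsAdmissible ∧
      ∀ (ζ : Rochberg.disc) (k : ℕ), 1 ≤ k → analyticOrderAt (deriv ω.toFun) (ζ : ℂ) = (k : ℕ∞) →
        ∀ n m : ℕ, 1 ≤ n → 1 ≤ m →
          (n + m ≤ k + 1 → (Rochberg.spaceZ ω).DifferentialVanishes ζ n m) ∧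
          (k + 2 ≤ n + m → (Rochberg.spaceZ ω).DifferentialNontrivial ζ n m)) ∧
    (∀ N : ℕ, 2 ≤ N →
      ∃ (F : Rochberg.FunctionSpace Rochberg.disc Rochberg.LInf) (ζ : Rochberg.disc),
        F.IsAdmissible ∧ Rochberg.FibreIsLp F ζ 2 ∧
        (∀ j : ℕ, 1 ≤ j → j < N → F.DifferentialVanishes ζ 1 j) ∧
        (∀ j : ℕ, N ≤ j → F.DifferentialNontrivial ζ 1 j)) ∧
    (∃ (F : Rochberg.FunctionSpace Rochberg.disc Rochberg.LInf) (ζ : Rochberg.disc),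
      F.IsAdmissible ∧ F.DifferentialVanishes ζ 1 1 ∧
      ∀ n m : ℕ, 1 ≤ n → 1 ≤ m → (n, m) ≠ (1, 1) → F.DifferentialNontrivial ζ n m) := by
  refine ⟨fun ω => ⟨Rochberg.spaceZ_isAdmissible ω, fun ζ k _ hord n m hn hm => ?_⟩,
    fun N hN => ?_, ?_⟩
  · obtain ⟨h, H, h0⟩ := ω.exists_isFactor ζ hord
    exact ⟨fun hnm => H.differentialVanishes hn hm hnm,
      fun hnm => H.differentialNontrivial h0 hn hm (by omega)⟩
  · have hN1 : 1 ≤ N := by omega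
    have H := Rochberg.powConfig_isFactor N hN1
    refine ⟨Rochberg.spaceZ (Rochberg.powConfig N hN1), Rochberg.discZero,
      Rochberg.spaceZ_isAdmissible _, ?_, fun j hj hjN => ?_, fun j hj => ?_⟩
    · rw [← Rochberg.powConfig_p N hN1]
      exact H.fibreIsLp
    · exact H.differentialVanishes le_rfl hj (by omega)
    · exact H.differentialNontrivial (by norm_num) le_rfl (by omega) (by omega)
  -- With N = 2 the range n + m ≤ N contains the pair (1, 1) only.
  · have H := Rochberg.powConfig_isFactor 2 one_le_two
    refine ⟨Rochberg.spaceZ (Rochberg.powConfig 2 one_le_two), Rochberg.discZero,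
      Rochberg.spaceZ_isAdmissible _, H.differentialVanishes le_rfl le_rfl le_rfl,
      fun n m hn hm hnm => H.differentialNontrivial (by norm_num) hn hm ?_⟩
    by_contra hlt
    exact hnm (Prod.ext (by simp only; omega) (by simp only; omega))
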